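/- Let $M$ be a smooth closed manifold and let $\mathcal F$ be a smooth foliation of $M$ by hyperbolic surfaces, i.e. a smooth foliation with two-dimensional leaves equipped with a smooth leafwise Riemannian metric $g_P$ of constant curvature $-1$. Let $\mathbb D=\{z\in\mathbb C: |z|<1\}$ carry the Poincaré metric $4|dz|^2/(1-|z|^2)^2$, with volume form $v_P=4\,dx\wedge dy/(1-|z|^2)^2$. For $\rho,\rho'>0$ let $0<R<R'<1$ be determined by $\rho=\frac12\log\frac{1+R}{1-R}$ and $\rho+\rho'=\frac12\log\frac{1+R'}{1-R'}$, and define $\psi_{\rho,\rho'}:\mathbb D\to[0,\infty)$ by $$\psi_{\rho,\rho'}(z)=\begin{cases}1 & |z|\le R,\\ \dfrac{R'-|z|}{R'-R} & R\le|z|\le R',\\ 0 & R'\le |z|<1.\end{cases}$$ Let $\mu_{\rho,\rho'}$ be the probability measure $\left(\int_{\mathbb D}\psi_{\rho,\rho'}v_P\right)^{-1}\psi_{\rho,\rho'}\,v_P$ on $\mathbb D$. For $x\in M$ let $L_x$ be the leaf through $x$, let $j_x:\mathbb D\cong\tilde L_x\to L_x\subset M$ be the composite of an isometric identification of $\mathbb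 D$ with the universal cover $\tilde L_x$ of $L_x$ and the covering projection, chosen so that $j_x(0)=x$, and put $\mu_{\rho,\rho'}(x)=(j_x)_*\mu_{\rho,\rho'}$, a Borel probability measure on $M$. **Theorem.** Let $x_n\in M$ and let $\rho_n,\rho_n'>0$ be sequences with $\rho_n\to\infty$ and $\rho_n'\to\infty$. If the measures $\mu_{\rho_n,\rho_n'}(x_n)$ converge weakly to a Borel probability measure $\mu$ on $M$, then $\mu$ is a harmonic measure of $\mathcal F$, i.e. for every $C^2$ function $f:M\to\mathbb R$ $$\int_M \Delta_P f\,d\mu=0,$$ where $\Delta_P$ is the leafwise Laplacian of the metric $g_P$. -/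

import Mathlib

open MeasureTheory Filter Topology Set
open scoped Manifold ContDiff

noncomputable section

/-! ## Riemannian metrics on open subsets of the plane

The plane is `ℂ`, regarded as `ℝ²`.  A metric is a map `h : ℂ → (ℂ →L[ℝ] ℂ →L[ℝ] ℝ)`, with the
usual coefficients `E = h(∂x, ∂x)`, `F = h(∂x, ∂y)`, `G = h(∂y, ∂y)`. -/

namespace PlaneMetric

/-- The partial derivative `∂u/∂x`, `z = x + i y`. -/
def dx (u : ℂ → ℝ) (z : ℂ) : ℝ := fderiv ℝ u z 1

/-- The partial derivative `∂u/∂y`, `z = x + i y`. -/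
def dy (u : ℂ → ℝ) (z : ℂ) : ℝ := fderiv ℝ u z Complex.I

/-- First coefficient of a metric. -/
def coeffE (h : ℂ → ℂ →L[ℝ] ℂ →L[ℝ] ℝ) (z : ℂ) : ℝ := h z 1 1

/-- Second (mixed) coefficient of a metric. -/
def coeffF (h : ℂ → ℂ →L[ℝ] ℂ →L[ℝ] ℝ) (z : ℂ) : ℝ := h z 1 Complex.I

/-- Third coefficient of a metric. -/
def coeffG (h : ℂ → ℂ →L[ℝ] ℂ →L[ℝ] ℝ) (z : ℂ) : ℝ := h z Complex.I Complex.I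

/-- The determinant `E G - F²`. -/
def gram (h : ℂ → ℂ →L[ℝ] ℂ →L[ℝ] ℝ) (z : ℂ) : ℝ :=
  coeffE h z * coeffG h z - coeffF h z ^ 2

/-- The Gaussian curvature of the metric `E dx² + 2 F dx dy + G dy²` (Brioschi's formula). -/
def gaussCurvature (h : ℂ → ℂ →L[ℝ] ℂ →L[ℝ] ℝ) (z : ℂ) : ℝ :=
  let E := coeffE h
  let F := coeffF h
  let G := coeffG h
  ((!![-(1 / 2) * dy (dy E) z + dy (dx F) z - (1 / 2) * dx (dx G) z, (1 / 2) * dx E z,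
          dx F z - (1 / 2) * dy E z;
        dy F z - (1 / 2) * dx G z, E z, F z;
        (1 / 2) * dy G z, F z, G z] : Matrix (Fin 3) (Fin 3) ℝ).det
    - (!![0, (1 / 2) * dy E z, (1 / 2) * dx G z;
          (1 / 2) * dy E z, E z, F z;
          (1 / 2) * dx G z, F z, G z] : Matrix (Fin 3) (Fin 3) ℝ).det) / gram h z ^ 2

/-- The Laplace-Beltrami operator `div grad u` of the metric `E dx² + 2 F dx dy + G dy²`,
that is `D⁻¹ (∂x ((G ∂x u - F ∂y u) / D) + ∂y ((E ∂y u - F ∂x u) / D))`, `D = √(E G - F²)`. -/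
def laplacian (h : ℂ → ℂ →L[ℝ] ℂ →L[ℝ] ℝ) (u : ℂ → ℝ) (z : ℂ) : ℝ :=
  (dx (fun w => (coeffG h w * dx u w - coeffF h w * dy u w) / √(gram h w)) z
    + dy (fun w => (coeffE h w * dy u w - coeffF h w * dx u w) / √(gram h w)) z) / √(gram h z)

end PlaneMetric

/-! ## Foliations by surfaces and leafwise metrics -/

/-- A smooth foliation with two-dimensional leaves of a smooth manifold `M` of dimension `q + 2`,
given by a smooth foliated atlas: charts `φ = (z, t)` with values in `ℝ² × ℝ^q = ℂ × ℝ^q` whose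
changes of coordinates are locally of the form `(z, t) ↦ (a (z, t), b t)`. -/
structure SurfaceFoliation (q : ℕ) (M : Type*) [TopologicalSpace M]
    [ChartedSpace (EuclideanSpace ℝ (Fin (q + 2))) M] where
  /-- the foliated charts -/
  atlas : Set (OpenPartialHomeomorph M (ℂ × EuclideanSpace ℝ (Fin q)))
  exists_chart : ∀ x : M, ∃ φ ∈ atlas, x ∈ φ.source
  smooth : ∀ φ ∈ atlas,
    ContMDiffOn (𝓡 (q + 2)) 𝓘(ℝ, ℂ × EuclideanSpace ℝ (Fin q)) ∞ φ φ.source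
  smooth_symm : ∀ φ ∈ atlas,
    ContMDiffOn 𝓘(ℝ, ℂ × EuclideanSpace ℝ (Fin q)) (𝓡 (q + 2)) ∞ φ.symm φ.target
  plaque : ∀ φ ∈ atlas, ∀ ψ ∈ atlas, ∀ p ∈ (φ.symm.trans ψ).source,
    ∃ U ∈ 𝓝 p, ∀ a ∈ U, ∀ b ∈ U, a.2 = b.2 → (ψ (φ.symm a)).2 = (ψ (φ.symm b)).2

namespace SurfaceFoliation

variable {q : ℕ} {M : Type*} [TopologicalSpace M]
  [ChartedSpace (EuclideanSpace ℝ (Fin (q + 2))) M]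

/-- The leaf topology on `M`, generated by the (open subsets of the) plaques `t = const`. -/
@[reducible] def leafTopology (F : SurfaceFoliation q M) : TopologicalSpace M :=
  TopologicalSpace.generateFrom
    {s | ∃ φ ∈ F.atlas, ∃ U : Set ℂ, IsOpen U ∧ ∃ t : EuclideanSpace ℝ (Fin q),
      s = φ.source ∩ φ ⁻¹' (U ×ˢ {t})}

/-- The leaf through `x`: the connected component of `x` in the leaf topology. -/
def Leaf (F : SurfaceFoliation q M) (x : M) : Type _ :=
  {y : M // y ∈ @connectedComponent M F.leafTopology x}

/-- A leaf carries the leaf topology. -/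
instance (F : SurfaceFoliation q M) (x : M) : TopologicalSpace (F.Leaf x) :=
  TopologicalSpace.induced Subtype.val F.leafTopology

/-- A foliated chart around `x`. -/
def chart (F : SurfaceFoliation q M) (x : M) :
    OpenPartialHomeomorph M (ℂ × EuclideanSpace ℝ (Fin q)) :=
  (F.exists_chart x).choose

/-- A smooth leafwise Riemannian metric: in each foliated chart `φ = (z, t)` a smooth family
`coeff φ (z, t)` of inner products on the tangent plane `ℝ² = ℂ` of the plaque, such that
changes of foliated coordinates transform the families into each other.  (The values of
`coeff` at partial homeomorphisms that are not foliated charts, or at points outside the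
target of the chart, are irrelevant.) -/
structure LeafMetric (F : SurfaceFoliation q M) where
  /-- the expression of the metric in a foliated chart -/
  coeff : OpenPartialHomeomorph M (ℂ × EuclideanSpace ℝ (Fin q)) →
    ℂ × EuclideanSpace ℝ (Fin q) → (ℂ →L[ℝ] ℂ →L[ℝ] ℝ)
  smooth : ∀ φ ∈ F.atlas, ContDiffOn ℝ ∞ (coeff φ) φ.target
  symm : ∀ φ ∈ F.atlas, ∀ p ∈ φ.target, ∀ v w, coeff φ p v w = coeff φ p w v
  pos : ∀ φ ∈ F.atlas, ∀ p ∈ φ.target, ∀ v, v ≠ 0 → 0 < coeff φ p v v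
  compat : ∀ φ ∈ F.atlas, ∀ ψ ∈ F.atlas, ∀ p ∈ (φ.symm.trans ψ).source, ∀ v w : ℂ,
    coeff φ p v w = coeff ψ (ψ (φ.symm p))
      (fderiv ℝ (fun p => ψ (φ.symm p)) p (v, 0)).1
      (fderiv ℝ (fun p => ψ (φ.symm p)) p (w, 0)).1

namespace LeafMetric

variable {F : SurfaceFoliation q M}

/-- The leafwise metric has constant Gaussian curvature `-1`. -/
def IsHyperbolic (g : F.LeafMetric) : Prop :=
  ∀ φ ∈ F.atlas, ∀ p ∈ φ.target,
    PlaneMetric.gaussCurvature (fun z => g.coeff φ (z, p.2)) p.1 = -1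

/-- The leafwise Laplacian `Δ_P f` of a function `f` on `M`, computed at `x` in a foliated chart
around `x`. -/
def leafLaplacian (g : F.LeafMetric) (f : M → ℝ) (x : M) : ℝ :=
  PlaneMetric.laplacian (fun z => g.coeff (F.chart x) (z, (F.chart x x).2))
    (fun z => f ((F.chart x).symm (z, (F.chart x x).2))) (F.chart x x).1

/-- A measure on `M` is harmonic if the leafwise Laplacian of every `C²` function has
integral zero. -/
def IsHarmonic [MeasurableSpace M] (g : F.LeafMetric) (μ : Measure M) : Prop :=
  ∀ f : M → ℝ, ContMDiff (𝓡 (q + 2)) 𝓘(ℝ, ℝ) 2 f →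
    Integrable (g.leafLaplacian f) μ ∧ ∫ x, g.leafLaplacian f x ∂μ = 0

/-- `j` (restricted to the unit disk `𝔻`) is the composite `𝔻 ≅ L̃ → L ⊆ M` of an isometry of `𝔻`,
with the Poincaré metric `4 |dz|² / (1 - |z|²)²`, onto the universal cover of the leaf `L`
through `x` and of the covering projection, and `j 0 = x`.  As `𝔻` is simply connected, this says
that `j` is a covering map from `𝔻` onto the leaf and a smooth local isometry. The values of `j`
outside `𝔻` are irrelevant. -/
structure IsLeafUniformization (g : F.LeafMetric) (x : M) (j : ℂ → M) : Prop where
  map_zero : j 0 = x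
  covering : ∃ p : Metric.ball (0 : ℂ) 1 → F.Leaf x,
    IsCoveringMap p ∧ ∀ z, (p z).val = j z
  smooth : ∀ φ ∈ F.atlas,
    ContDiffOn ℝ ∞ (fun z => (φ (j z)).1) (Metric.ball (0 : ℂ) 1 ∩ j ⁻¹' φ.source)
  isometry : ∀ φ ∈ F.atlas, ∀ z ∈ Metric.ball (0 : ℂ) 1, j z ∈ φ.source → ∀ v w : ℂ,
    g.coeff φ (φ (j z)) (fderiv ℝ (fun z => (φ (j z)).1) z v)
        (fderiv ℝ (fun z => (φ (j z)).1) z w)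
      = 4 / (1 - ‖z‖ ^ 2) ^ 2 * inner ℝ v w

end LeafMetric

end SurfaceFoliation

/-! ## The averaging measures -/

namespace PoincareDisk

/-- The function `ψ_{ρ,ρ'}`: with `R = tanh ρ` and `R' = tanh (ρ + ρ')`, that is
`ρ = (1/2) log ((1 + R) / (1 - R))` and `ρ + ρ' = (1/2) log ((1 + R') / (1 - R'))`, it is `1` for
`|z| ≤ R`, `(R' - |z|) / (R' - R)` for `R ≤ |z| ≤ R'`, and `0` for `R' ≤ |z|`. -/
def cutoff (ρ ρ' : ℝ) (z : ℂ) : ℝ :=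
  if ‖z‖ ≤ Real.tanh ρ then 1
  else if ‖z‖ ≤ Real.tanh (ρ + ρ') then
    (Real.tanh (ρ + ρ') - ‖z‖) / (Real.tanh (ρ + ρ') - Real.tanh ρ)
  else 0

/-- The measure `ψ_{ρ,ρ'} v_P` on the unit disk, where `v_P = 4 dx dy / (1 - |z|²)²`. -/
def cutoffVolume (ρ ρ' : ℝ) : Measure ℂ :=
  (volume.restrict (Metric.ball (0 : ℂ) 1)).withDensity
    fun z => ENNReal.ofReal (cutoff ρ ρ' z * (4 / (1 - ‖z‖ ^ 2) ^ 2))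

/-- The probability measure `μ_{ρ,ρ'}` on the unit disk: `ψ_{ρ,ρ'} v_P`, normalized. -/
def diskMeasure (ρ ρ' : ℝ) : Measure ℂ :=
  (cutoffVolume ρ ρ' univ)⁻¹ • cutoffVolume ρ ρ'

end PoincareDisk

end

/-! Pull `f` back to the disk by the uniformization: `u = f ∘ j` is `C²` and bounded by `C = sup
|f|`, uniformly in the base point. In dimension two the Laplacian times the area form is conformally
invariant, so integrating `Δ_P f` against `ψ v_P` amounts to integrating the Euclidean Laplacian of
`u` against the radial cutoff, affine between `a = tanh ρ` and `b = tanh (ρ + ρ')`. In polar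
coordinates the angular part integrates to zero. Two integrations by parts in `r` put both
derivatives on the cutoff and leave at most `4πC / (b - a)`
(`abs_setIntegral_radialCutoff_mul_laplacian_le`). One integration by parts bounds the total mass
below by `4π(ρ' - 1) / (b - a)` (`le_setIntegral_radialCutoff_mul_density`). The width `b - a`,
which may be tiny, cancels in the quotient: the normalized integral is at most `C / (ρ' - 1)`, which
tends to zero. The limit passes to `μ` because `Δ_P f` is continuous on `M`. Its continuity, and its
expression on the disk, rest on the coordinate invariance of the Laplace-Beltrami operator
(`PlaneMetric.laplacian_comp`). -/

noncomputable section

/-! ### Radial cutoffs on the disk: the Laplacian and area estimates. -/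

namespace PoincareDisk

/-- The radial profile of the cutoff function: `1` up to `a`, `0` from `b` on, affine in between. -/
def radialCutoff (a b r : ℝ) : ℝ :=
  if r ≤ a then 1 else if r ≤ b then (b - r) / (b - a) else 0

theorem cutoff_eq_radialCutoff (ρ ρ' : ℝ) (z : ℂ) :
    cutoff ρ ρ' z = radialCutoff (Real.tanh ρ) (Real.tanh (ρ + ρ')) ‖z‖ := rfl

section RadialCutoff

variable {a b : ℝ}

/-- Clamping the affine function to `[0, 1]` gives continuity and nonnegativity without a case
analysis at the break points. -/
theorem radialCutoff_eq_max_min (hab : a < b) (r : ℝ) :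
    radialCutoff a b r = max 0 (min 1 ((b - r) / (b - a))) := by
  have h : 0 < b - a := sub_pos.2 hab
  unfold radialCutoff
  split_ifs with h1 h2
  · rw [min_eq_left, max_eq_right zero_le_one]
    rw [le_div_iff₀ h]; linarith
  · rw [min_eq_right, max_eq_right]
    · exact div_nonneg (by linarith) h.le
    · rw [div_le_iff₀ h]; linarith
  · rw [max_eq_left]
    exact (min_le_right _ _).trans (div_nonpos_of_nonpos_of_nonneg (by linarith) h.le)

theorem continuous_radialCutoff (hab : a < b) : Continuous (radialCutoff a b) := by
  rw [funext (radialCutoff_eq_max_min hab)]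
  fun_prop

theorem radialCutoff_nonneg (hab : a < b) (r : ℝ) : 0 ≤ radialCutoff a b r := by
  rw [radialCutoff_eq_max_min hab]; exact le_max_left _ _

theorem radialCutoff_of_le {r : ℝ} (h : r ≤ a) : radialCutoff a b r = 1 := if_pos h

theorem radialCutoff_of_mem_Icc (hab : a < b) {r : ℝ} (h : r ∈ Icc a b) :
    radialCutoff a b r = (b - r) / (b - a) := by
  rcases h.1.eq_or_lt with rfl | h1
  · rw [radialCutoff_of_le le_rfl, div_self (sub_pos.2 hab).ne']
  · rw [radialCutoff, if_neg h1.not_ge, if_pos h.2]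

theorem radialCutoff_of_lt (hab : a < b) {r : ℝ} (h : b < r) : radialCutoff a b r = 0 := by
  rw [radialCutoff, if_neg (by linarith), if_neg (by linarith)]

/-- A continuous function on the unit disk becomes integrable when multiplied by a cutoff. -/
theorem integrableOn_radialCutoff_mul (hab : a < b) (hb : b < 1) {F : ℂ → ℝ}
    (hF : ContinuousOn F (Metric.ball 0 1)) :
    IntegrableOn (fun z => radialCutoff a b ‖z‖ * F z) (Metric.ball (0 : ℂ) 1) := by
  have hsub : Metric.closedBall (0 : ℂ) b ⊆ Metric.ball 0 1 := Metric.closedBall_subset_ball hb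
  have h1 : IntegrableOn (fun z => radialCutoff a b ‖z‖ * F z) (Metric.closedBall (0 : ℂ) b) := by
    refine ContinuousOn.integrableOn_compact (isCompact_closedBall _ _) ?_
    exact ((continuous_radialCutoff hab).comp continuous_norm).continuousOn.mul (hF.mono hsub)
  refine h1.of_forall_sdiff_eq_zero Metric.isOpen_ball.measurableSet ?_
  intro z hz
  rw [radialCutoff_of_lt hab, zero_mul]
  simpa using hz.2

/-- Since the cutoff vanishes past `b < 1`, polar coordinates reduce to a compact rectangle on which
the integrand is continuous, so Fubini applies even if `F` blows up at the unit circle. -/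
theorem setIntegral_radialCutoff_mul (hab : a < b) (ha : 0 < a) (hb : b < 1) {F : ℂ → ℝ}
    (hF : ContinuousOn F (Metric.ball 0 1)) :
    ∫ z in Metric.ball (0 : ℂ) 1, radialCutoff a b ‖z‖ * F z =
      ∫ θ in (-Real.pi)..Real.pi, ∫ r in (0 : ℝ)..b,
        radialCutoff a b r * (r * F (r * Complex.exp (θ * Complex.I))) := by
  have hb0 : 0 < b := ha.trans hab
  have hcont : ContinuousOn (fun p : ℝ × ℝ =>
      radialCutoff a b p.1 * (p.1 * F (p.1 * Complex.exp (p.2 * Complex.I))))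
      (Icc 0 b ×ˢ Icc (-Real.pi) Real.pi) := by
    refine ((continuous_radialCutoff hab).comp continuous_fst).continuousOn.mul
      (continuous_fst.continuousOn.mul (hF.comp (by fun_prop) ?_))
    rintro ⟨r, θ⟩ ⟨hr, -⟩
    simp only [mem_Icc] at hr
    simp [Complex.norm_exp_ofReal_mul_I, abs_of_nonneg hr.1]
    linarith
  have hint := hcont.integrableOn_compact (μ := volume) (isCompact_Icc.prod isCompact_Icc)
  have hpi : -Real.pi ≤ Real.pi := by linarith [Real.pi_pos]
  rw [← integral_indicator Metric.isOpen_ball.measurableSet, ← Complex.integral_comp_polarCoord_symm]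
  have h2 : ∀ p ∈ polarCoord.target, p.1 • (Metric.ball (0 : ℂ) 1).indicator
        (fun z => radialCutoff a b ‖z‖ * F z) (Complex.polarCoord.symm p) =
      (Ioc 0 b ×ˢ Ioc (-Real.pi) Real.pi).indicator (fun p : ℝ × ℝ =>
        radialCutoff a b p.1 * (p.1 * F (p.1 * Complex.exp (p.2 * Complex.I)))) p := by
    rintro ⟨r, θ⟩ ⟨hr, hθ⟩
    simp only [mem_Ioi] at hr
    have hz : Complex.polarCoord.symm (r, θ) = r * Complex.exp (θ * Complex.I) := by
      rw [Complex.polarCoord_symm_apply, Complex.exp_mul_I]; simp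
    have hn : ‖Complex.polarCoord.symm (r, θ)‖ = r := by
      rw [Complex.norm_polarCoord_symm, abs_of_pos hr]
    by_cases hrb : r ≤ b
    · rw [indicator_of_mem, indicator_of_mem, hn, hz, smul_eq_mul]
      · ring
      · exact ⟨⟨hr, hrb⟩, hθ.1, hθ.2.le⟩
      · rw [mem_ball_zero_iff, hn]; linarith
    · rw [indicator_of_notMem (s := Ioc 0 b ×ˢ _) (fun h => hrb h.1.2)]
      rw [indicator_apply_eq_zero.2, smul_zero]
      intro _
      rw [hn, radialCutoff_of_lt hab (not_le.1 hrb), zero_mul]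
  rw [setIntegral_congr_fun polarCoord.open_target.measurableSet h2,
    setIntegral_indicator (measurableSet_Ioc.prod measurableSet_Ioc)]
  have h3 : polarCoord.target ∩ Ioc 0 b ×ˢ Ioc (-Real.pi) Real.pi =
      Ioc 0 b ×ˢ Ioo (-Real.pi) Real.pi := by
    ext ⟨r, θ⟩
    simp only [polarCoord_target, mem_inter_iff, mem_prod, mem_Ioi, mem_Ioo, mem_Ioc]
    constructor
    · rintro ⟨⟨h1, h2, h3⟩, ⟨h4, h5⟩, -⟩; exact ⟨⟨h4, h5⟩, h2, h3⟩
    · rintro ⟨⟨h1, h2⟩, h3, h4⟩; exact ⟨⟨h1, h3, h4⟩, ⟨h1, h2⟩, h3, h4.le⟩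
  rw [h3, Measure.volume_eq_prod, setIntegral_prod, integral_integral_swap,
    intervalIntegral.integral_of_le hpi, integral_Ioc_eq_integral_Ioo]
  · simp_rw [intervalIntegral.integral_of_le hb0.le]
  · rw [Measure.prod_restrict, ← Measure.volume_eq_prod]
    exact hint.mono_set (prod_mono Ioc_subset_Icc_self Ioo_subset_Icc_self)
  · exact hint.mono_set (prod_mono Ioc_subset_Icc_self Ioo_subset_Icc_self)

/-- Integration by parts against the radial cutoff. -/
theorem integral_radialCutoff_mul_deriv (hab : a < b) (ha : 0 < a) {V V' : ℝ → ℝ}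
    (hV : ∀ r ∈ Icc 0 b, HasDerivAt V (V' r) r) (hV' : ContinuousOn V' (Icc 0 b)) (h0 : V 0 = 0) :
    ∫ r in (0 : ℝ)..b, radialCutoff a b r * V' r = (∫ r in a..b, V r) / (b - a) := by
  have hba : b - a ≠ 0 := (sub_pos.2 hab).ne'
  have i1 : IntervalIntegrable V' volume 0 a :=
    (hV'.mono (by rw [uIcc_of_le ha.le]; exact Icc_subset_Icc_right hab.le)).intervalIntegrable
  have i2 : IntervalIntegrable V' volume a b :=
    (hV'.mono (by rw [uIcc_of_le hab.le]; exact Icc_subset_Icc_left ha.le)).intervalIntegrable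
  have j1 := i1.continuousOn_mul (continuous_radialCutoff hab).continuousOn
  have j2 := i2.continuousOn_mul (continuous_radialCutoff hab).continuousOn
  rw [← intervalIntegral.integral_add_adjacent_intervals j1 j2]
  -- The boundary terms at `a` from the two pieces cancel, and those at `0` and `b` vanish; what
  -- remains is `V` against the slope `-1 / (b - a)`.
  have e1 : ∫ r in (0 : ℝ)..a, radialCutoff a b r * V' r = V a := by
    rw [intervalIntegral.integral_congr (g := V')]
    · rw [intervalIntegral.integral_eq_sub_of_hasDerivAt (f := V) _ i1, h0, sub_zero]
      intro r hr
      rw [uIcc_of_le ha.le] at hr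
      exact hV r ⟨hr.1, hr.2.trans hab.le⟩
    · intro r hr
      rw [uIcc_of_le ha.le] at hr
      simp [radialCutoff_of_le hr.2]
  have e2 : ∫ r in a..b, radialCutoff a b r * V' r =
      -V a + (∫ r in a..b, V r) / (b - a) := by
    rw [intervalIntegral.integral_congr (g := fun r => (b - r) / (b - a) * V' r)]
    · rw [intervalIntegral.integral_mul_deriv_eq_deriv_mul
        (u := fun r => (b - r) / (b - a)) (v := V) (u' := fun _ => -1 / (b - a)) _ _ _ i2]
      · rw [intervalIntegral.integral_const_mul]
        field_simp
        ring
      · intro r _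
        exact ((hasDerivAt_id r).const_sub b).div_const _
      · intro r hr
        rw [uIcc_of_le hab.le] at hr
        exact hV r ⟨ha.le.trans hr.1, hr.2⟩
      · exact intervalIntegrable_const
    · intro r hr
      rw [uIcc_of_le hab.le] at hr
      simp only [radialCutoff_of_mem_Icc hab hr]
  rw [e1, e2]; ring

end RadialCutoff

/-- The Euclidean Laplacian of a `C²` function in polar coordinates, integrated against a radial
cutoff: only the size of the function enters. -/
theorem abs_setIntegral_radialCutoff_mul_laplacian_le {a b C : ℝ} (hab : a < b) (ha : 0 < a)
    (hb : b < 1) {u : ℂ → ℝ} (hu : ContDiffOn ℝ 2 u (Metric.ball 0 1))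
    (hC : ∀ z ∈ Metric.ball (0 : ℂ) 1, |u z| ≤ C) :
    |∫ z in Metric.ball (0 : ℂ) 1, radialCutoff a b ‖z‖ *
        (PlaneMetric.dx (PlaneMetric.dx u) z + PlaneMetric.dy (PlaneMetric.dy u) z)| ≤
      4 * Real.pi * C / (b - a) := by
  have hb0 : 0 < b := ha.trans hab
  have hpi : -Real.pi ≤ Real.pi := by linarith [Real.pi_pos]
  have hopen : IsOpen (Metric.ball (0 : ℂ) 1) := Metric.isOpen_ball
  have hC0 : 0 ≤ C := (abs_nonneg _).trans (hC 0 (by simp))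
  set D := fderiv ℝ u with hD
  have hD1 : ContDiffOn ℝ 1 D (Metric.ball 0 1) := hu.fderiv_of_isOpen hopen (by norm_num)
  set H := fderiv ℝ D with hH
  have hHc : ContinuousOn H (Metric.ball 0 1) := hD1.continuousOn_fderiv_of_isOpen hopen le_rfl
  have hud : ∀ z ∈ Metric.ball (0 : ℂ) 1, HasFDerivAt u (D z) z := fun z hz =>
    ((hu.differentiableOn (by norm_num)).differentiableAt (hopen.mem_nhds hz)).hasFDerivAt
  have hDd : ∀ z ∈ Metric.ball (0 : ℂ) 1, HasFDerivAt D (H z) z := fun z hz =>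
    ((hD1.differentiableOn (by norm_num)).differentiableAt (hopen.mem_nhds hz)).hasFDerivAt
  have hlap : ∀ z ∈ Metric.ball (0 : ℂ) 1,
      PlaneMetric.dx (PlaneMetric.dx u) z + PlaneMetric.dy (PlaneMetric.dy u) z =
        H z 1 1 + H z Complex.I Complex.I := by
    intro z hz
    have h (v : ℂ) : fderiv ℝ (fun w => fderiv ℝ u w v) z v = H z v v := by
      have := ((hDd z hz).clm_apply (hasFDerivAt_const v z)).fderiv
      rw [← hD, this]; simp
    exact congrArg₂ (· + ·) (h 1) (h Complex.I)
  set e : ℝ → ℂ := fun θ => Complex.exp (θ * Complex.I) with he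
  have hec : Continuous e := by fun_prop
  have hen : ∀ θ, ‖e θ‖ = 1 := fun θ => Complex.norm_exp_ofReal_mul_I θ
  have hed : ∀ θ, HasDerivAt e (e θ * Complex.I) θ := by
    intro θ
    have := ((Complex.ofRealCLM.hasDerivAt (x := θ)).mul_const Complex.I).cexp
    simpa using this
  have hmem : ∀ r ∈ Icc (0 : ℝ) b, ∀ θ, (r : ℂ) * e θ ∈ Metric.ball (0 : ℂ) 1 := by
    intro r hr θ
    rw [mem_ball_zero_iff, norm_mul, hen, mul_one, Complex.norm_real, Real.norm_eq_abs,
      abs_of_nonneg hr.1]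
    linarith [hr.2]
  have hprod {E : Type} [TopologicalSpace E] {f : ℂ → E} (hf : ContinuousOn f (Metric.ball 0 1)) :
      ContinuousOn (fun p : ℝ × ℝ => f (p.1 * e p.2)) (Icc 0 b ×ˢ univ) :=
    hf.comp (by fun_prop) (fun p hp => hmem p.1 hp.1 p.2)
  have hrd : ∀ r θ, HasDerivAt (fun s : ℝ => (s : ℂ) * e θ) (e θ) r := by
    intro r θ
    simpa using (Complex.ofRealCLM.hasDerivAt (x := r)).mul_const (e θ)
  have hθd : ∀ r θ : ℝ, HasDerivAt (fun t : ℝ => (r : ℂ) * e t) (r * (e θ * Complex.I)) θ :=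
    fun r θ => (hed θ).const_mul _
  -- the radial part `∂_r (r ∂_r u)` and the angular part
  set P : ℝ → ℝ → ℝ := fun θ r =>
    D (r * e θ) (e θ) + r * H (r * e θ) (e θ) (e θ) with hP
  set Q : ℝ → ℝ → ℝ := fun θ r =>
    r * H (r * e θ) (e θ * Complex.I) (e θ * Complex.I) - D (r * e θ) (e θ) with hQ
  have hsplit : ∀ θ, ∀ r ∈ Icc (0 : ℝ) b, r * (PlaneMetric.dx (PlaneMetric.dx u) (r * e θ) +
      PlaneMetric.dy (PlaneMetric.dy u) (r * e θ)) = P θ r + Q θ r := by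
    intro θ r hr
    rw [hlap _ (hmem r hr θ)]
    set B := H (r * e θ)
    have h1 : e θ = Real.cos θ • (1 : ℂ) + Real.sin θ • Complex.I := by
      simp [he, Complex.exp_mul_I]
    have h2 : e θ * Complex.I = (-Real.sin θ) • (1 : ℂ) + Real.cos θ • Complex.I := by
      rw [h1]
      apply Complex.ext <;> simp
    -- The trace of a bilinear form is the same in every orthonormal frame, here the radial and
    -- angular unit vectors.
    have h3 : B 1 1 + B Complex.I Complex.I =
        B (e θ) (e θ) + B (e θ * Complex.I) (e θ * Complex.I) := by
      rw [h2, h1]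
      simp only [map_add, map_smul, add_apply, smul_apply, smul_eq_mul]
      linear_combination (-(B 1 1) - B Complex.I Complex.I) * Real.sin_sq_add_cos_sq θ
    rw [h3]
    simp only [hP, hQ]; ring
  have hDc : ContinuousOn (fun p : ℝ × ℝ => D (p.1 * e p.2) (e p.2)) (Icc 0 b ×ˢ univ) :=
    (hprod hD1.continuousOn).clm_apply (by fun_prop)
  have hPc : ContinuousOn (fun p : ℝ × ℝ => P p.2 p.1) (Icc 0 b ×ˢ univ) :=
    hDc.add (continuous_fst.continuousOn.mul
      (((hprod hHc).clm_apply (by fun_prop)).clm_apply (by fun_prop)))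
  have hQc : ContinuousOn (fun p : ℝ × ℝ => Q p.2 p.1) (Icc 0 b ×ˢ univ) :=
    (continuous_fst.continuousOn.mul
      (((hprod hHc).clm_apply (by fun_prop)).clm_apply (by fun_prop))).sub hDc
  have hχ := continuous_radialCutoff hab
  have slice {f : ℝ → ℝ → ℝ} (hf : ContinuousOn (fun p : ℝ × ℝ => f p.2 p.1) (Icc 0 b ×ˢ univ))
      (θ : ℝ) : ContinuousOn (f θ) (Icc 0 b) :=
    hf.comp (f := fun r => (r, θ)) (by fun_prop) (fun r hr => ⟨hr, mem_univ _⟩)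
  have slice' {f : ℝ → ℝ → ℝ} (hf : ContinuousOn (fun p : ℝ × ℝ => f p.2 p.1) (Icc 0 b ×ˢ univ))
      {r : ℝ} (hr : r ∈ Icc 0 b) : Continuous (fun θ => f θ r) := by
    rw [← continuousOn_univ]
    exact hf.comp (f := fun θ => (r, θ)) (by fun_prop) (fun θ _ => ⟨hr, mem_univ _⟩)
  have hii {f : ℝ → ℝ} (hf : ContinuousOn f (Icc 0 b)) :
      IntervalIntegrable (fun r => radialCutoff a b r * f r) volume 0 b :=
    ContinuousOn.intervalIntegrable (by
      rw [uIcc_of_le hb0.le]; exact hχ.continuousOn.mul hf)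
  have swap {f : ℝ → ℝ → ℝ} (hf : ContinuousOn (fun p : ℝ × ℝ => f p.2 p.1) (Icc 0 b ×ˢ univ)) :
      IntegrableOn (Function.uncurry fun θ r => radialCutoff a b r * f θ r)
        (uIoc (-Real.pi) Real.pi ×ˢ uIoc 0 b) := by
    rw [uIoc_of_le hpi, uIoc_of_le hb0.le]
    have : ContinuousOn (Function.uncurry fun θ r => radialCutoff a b r * f θ r)
        (Icc (-Real.pi) Real.pi ×ˢ Icc 0 b) :=
      (hχ.comp continuous_snd).continuousOn.mul
        (hf.comp (f := Prod.swap) continuous_swap.continuousOn (fun p hp => ⟨hp.2, mem_univ _⟩))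
    exact (this.integrableOn_compact (isCompact_Icc.prod isCompact_Icc)).mono_set
      (prod_mono Ioc_subset_Icc_self Ioc_subset_Icc_self)
  have iswap {f : ℝ → ℝ → ℝ} (hf : ContinuousOn (fun p : ℝ × ℝ => f p.2 p.1) (Icc 0 b ×ˢ univ)) :
      IntervalIntegrable (fun θ => ∫ r in (0 : ℝ)..b, radialCutoff a b r * f θ r) volume
        (-Real.pi) Real.pi := by
    rw [intervalIntegrable_iff]
    have := (swap hf)
    rw [IntegrableOn, Measure.volume_eq_prod, ← Measure.prod_restrict] at this
    have := this.integral_prod_left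
    simp only [Function.uncurry, uIoc_of_le hb0.le, ← intervalIntegral.integral_of_le hb0.le] at this
    exact this
  -- the angular part integrates to zero
  have hQint : ∀ r ∈ Icc (0 : ℝ) b, r ≠ 0 → ∫ θ in (-Real.pi)..Real.pi, Q θ r = 0 := by
    intro r hr hr0
    -- `Q` is the `θ`-derivative of a `2π`-periodic function, the derivative of `u` along the
    -- angular unit vector; its term `-D` comes from the rotation of that vector.
    have hd : ∀ θ, HasDerivAt (fun θ : ℝ => D (r * e θ) (e θ * Complex.I)) (Q θ r) θ := by
      intro θ
      have h1 : HasDerivAt (fun θ : ℝ => D (r * e θ)) (H (r * e θ) (r * (e θ * Complex.I))) θ :=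
        (hDd _ (hmem r hr θ)).comp_hasDerivAt θ (hθd r θ)
      have h2 := h1.clm_apply ((hed θ).mul_const Complex.I)
      refine h2.congr_deriv ?_
      change _ = r * H (r * e θ) (e θ * Complex.I) (e θ * Complex.I) - D (r * e θ) (e θ)
      have e1 : (r : ℂ) * (e θ * Complex.I) = r • (e θ * Complex.I) := by simp
      have e2 : e θ * Complex.I * Complex.I = -e θ := by rw [mul_assoc]; simp
      rw [e1, e2]
      simp only [map_smul, smul_apply, smul_eq_mul, map_neg]
      ring
    rw [intervalIntegral.integral_eq_sub_of_hasDerivAt (fun θ _ => hd θ)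
      ((slice' hQc hr).intervalIntegrable _ _)]
    have : e Real.pi = e (-Real.pi) := by
      simp [he, Complex.exp_pi_mul_I, Complex.exp_neg]
    rw [this, sub_self]
  -- the radial part
  have hPint : ∀ θ, |∫ r in (0 : ℝ)..b, radialCutoff a b r * P θ r| ≤ 2 * C / (b - a) := by
    intro θ
    have hd1 : ∀ r ∈ Icc (0 : ℝ) b,
        HasDerivAt (fun r : ℝ => u (r * e θ)) (D (r * e θ) (e θ)) r := fun r hr =>
      (hud _ (hmem r hr θ)).comp_hasDerivAt r (hrd r θ)
    have hd2 : ∀ r ∈ Icc (0 : ℝ) b,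
        HasDerivAt (fun r : ℝ => r * D (r * e θ) (e θ)) (P θ r) r := by
      intro r hr
      have h1 : HasDerivAt (fun r : ℝ => D (r * e θ)) (H (r * e θ) (e θ)) r :=
        (hDd _ (hmem r hr θ)).comp_hasDerivAt r (hrd r θ)
      have h2 := (hasDerivAt_id r).mul (h1.clm_apply (hasDerivAt_const r (e θ)))
      refine h2.congr_deriv ?_
      simp [hP]
    rw [integral_radialCutoff_mul_deriv hab ha hd2 (slice hPc θ) (by simp), abs_div,
      abs_of_pos (sub_pos.2 hab)]
    refine div_le_div_of_nonneg_right ?_ (sub_pos.2 hab).le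
    have hsub : uIcc a b ⊆ Icc 0 b := by
      rw [uIcc_of_le hab.le]; exact Icc_subset_Icc_left ha.le
    have hDi : IntervalIntegrable (fun r : ℝ => D (r * e θ) (e θ)) volume a b :=
      ((slice (f := fun θ r => D (r * e θ) (e θ)) hDc θ).mono hsub).intervalIntegrable
    -- A second integration by parts removes the last derivative of `u`. The three resulting terms
    -- add up to at most `bC + aC + (b - a)C = 2bC ≤ 2C`.
    rw [intervalIntegral.integral_mul_deriv_eq_deriv_mul (u := fun r => r) (u' := fun _ => 1)
      (v := fun r : ℝ => u (r * e θ)) (fun r _ => hasDerivAt_id r) (fun r hr => hd1 r (hsub hr))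
      intervalIntegrable_const hDi]
    have b1 : |u (b * e θ)| ≤ C := hC _ (hmem b ⟨hb0.le, le_rfl⟩ θ)
    have b2 : |u (a * e θ)| ≤ C := hC _ (hmem a ⟨ha.le, hab.le⟩ θ)
    have b3 : |∫ r in a..b, 1 * u (r * e θ)| ≤ C * (b - a) := by
      have := intervalIntegral.norm_integral_le_of_norm_le_const (a := a) (b := b) (C := C)
        (f := fun r : ℝ => 1 * u (r * e θ)) (fun r hr => by
          rw [one_mul, Real.norm_eq_abs]
          exact hC _ (hmem r (hsub (uIoc_subset_uIcc hr)) θ))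
      rwa [abs_of_pos (sub_pos.2 hab), Real.norm_eq_abs] at this
    have b4 : |b * u (b * e θ)| ≤ b * C := by
      rw [abs_mul, abs_of_pos hb0]; exact mul_le_mul_of_nonneg_left b1 hb0.le
    have b5 : |a * u (a * e θ)| ≤ a * C := by
      rw [abs_mul, abs_of_pos ha]; exact mul_le_mul_of_nonneg_left b2 ha.le
    calc _ ≤ |b * u (b * e θ)| + |a * u (a * e θ)| + |∫ r in a..b, 1 * u (r * e θ)| :=
          (abs_sub _ _).trans (add_le_add_left (abs_sub _ _) _)
      _ ≤ 2 * C := by nlinarith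
  have hcontLap : ContinuousOn (fun z => PlaneMetric.dx (PlaneMetric.dx u) z +
      PlaneMetric.dy (PlaneMetric.dy u) z) (Metric.ball 0 1) := by
    refine ContinuousOn.congr ?_ hlap
    exact ((hHc.clm_apply continuousOn_const).clm_apply continuousOn_const).add
      ((hHc.clm_apply continuousOn_const).clm_apply continuousOn_const)
  rw [setIntegral_radialCutoff_mul hab ha hb hcontLap]
  have hsum : ∀ θ : ℝ, (∫ r in (0 : ℝ)..b, radialCutoff a b r * (r *
      (PlaneMetric.dx (PlaneMetric.dx u) (r * Complex.exp (θ * Complex.I)) +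
        PlaneMetric.dy (PlaneMetric.dy u) (r * Complex.exp (θ * Complex.I))))) =
      (∫ r in (0 : ℝ)..b, radialCutoff a b r * P θ r) +
        ∫ r in (0 : ℝ)..b, radialCutoff a b r * Q θ r := by
    intro θ
    rw [← intervalIntegral.integral_add (hii (slice hPc θ)) (hii (slice hQc θ))]
    refine intervalIntegral.integral_congr fun r hr => ?_
    rw [uIcc_of_le hb0.le] at hr
    simp only [← mul_add]
    rw [← hsplit θ r hr]
  simp_rw [hsum]
  rw [intervalIntegral.integral_add (iswap hPc) (iswap hQc),
    MeasureTheory.intervalIntegral_intervalIntegral_swap (swap hQc)]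
  have hz : ∫ r in (0 : ℝ)..b, ∫ θ in (-Real.pi)..Real.pi, radialCutoff a b r * Q θ r = 0 := by
    rw [intervalIntegral.integral_of_le hb0.le]
    refine setIntegral_eq_zero_of_forall_eq_zero fun r hr => ?_
    rw [intervalIntegral.integral_const_mul, hQint r ⟨hr.1.le, hr.2⟩ hr.1.ne', mul_zero]
  rw [hz, add_zero]
  have := intervalIntegral.norm_integral_le_of_norm_le_const (a := -Real.pi) (b := Real.pi)
    (f := fun θ => ∫ r in (0 : ℝ)..b, radialCutoff a b r * P θ r) (fun θ _ => hPint θ)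
  rw [Real.norm_eq_abs, show Real.pi - -Real.pi = 2 * Real.pi by ring,
    abs_of_pos (mul_pos two_pos Real.pi_pos)] at this
  refine this.trans (le_of_eq ?_)
  ring

/-- Lower bound for the hyperbolic area weighted by a radial cutoff. -/
theorem le_setIntegral_radialCutoff_mul_density {a b : ℝ} (hab : a < b) (ha : 0 < a) (hb : b < 1) :
    4 * Real.pi * (Real.artanh b - Real.artanh a - 1) / (b - a) ≤
      ∫ z in Metric.ball (0 : ℂ) 1, radialCutoff a b ‖z‖ * (4 / (1 - ‖z‖ ^ 2) ^ 2) := by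
  have hb0 : 0 < b := ha.trans hab
  have hba : 0 < b - a := sub_pos.2 hab
  have hden : ∀ z ∈ Metric.ball (0 : ℂ) 1, (1 - ‖z‖ ^ 2) ^ 2 ≠ 0 := by
    intro z hz
    rw [mem_ball_zero_iff] at hz
    have : 0 < 1 - ‖z‖ ^ 2 := by nlinarith [norm_nonneg z]
    positivity
  have hr2 : ∀ r ∈ Icc (0 : ℝ) b, 0 < 1 - r ^ 2 := fun r hr => by nlinarith [hr.1, hr.2]
  rw [setIntegral_radialCutoff_mul hab ha hb (F := fun z => 4 / (1 - ‖z‖ ^ 2) ^ 2)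
    (ContinuousOn.div continuousOn_const (by fun_prop) hden)]
  have hn : ∀ θ : ℝ, (∫ r in (0 : ℝ)..b, radialCutoff a b r *
      (r * (4 / (1 - ‖(r : ℂ) * Complex.exp (θ * Complex.I)‖ ^ 2) ^ 2))) =
      ∫ r in (0 : ℝ)..b, radialCutoff a b r * (r * (4 / (1 - r ^ 2) ^ 2)) := by
    intro θ
    simp [Complex.norm_exp_ofReal_mul_I]
  simp_rw [hn]
  -- The constant `-2` makes the primitive vanish at `0`, as the integration by parts requires.
  have hd : ∀ r ∈ Icc (0 : ℝ) b,
      HasDerivAt (fun r : ℝ => 2 / (1 - r ^ 2) - 2) (r * (4 / (1 - r ^ 2) ^ 2)) r := by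
    intro r hr
    have h := (((hasDerivAt_pow 2 r).const_sub 1).fun_inv (hr2 r hr).ne').const_mul 2 |>.sub_const 2
    refine h.congr_deriv ?_
    field_simp [(hr2 r hr).ne']
    push_cast
    ring
  have hc : ContinuousOn (fun r : ℝ => r * (4 / (1 - r ^ 2) ^ 2)) (Icc 0 b) :=
    continuousOn_id.mul (ContinuousOn.div continuousOn_const (by fun_prop)
      fun r hr => (pow_pos (hr2 r hr) 2).ne')
  rw [integral_radialCutoff_mul_deriv hab ha hd hc (by norm_num)]
  have hsub : uIcc a b ⊆ Icc 0 b := by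
    rw [uIcc_of_le hab.le]; exact Icc_subset_Icc_left ha.le
  have hA : ∀ r ∈ uIcc a b, HasDerivAt (fun r : ℝ => (Real.log (1 + r) - Real.log (1 - r)) - 2 * r)
      (2 / (1 - r ^ 2) - 2) r := by
    intro r hr
    have hr' := hsub hr
    have p1 : 1 + r ≠ 0 := by linarith [hr'.1]
    have p2 : 1 - r ≠ 0 := by linarith [hr'.2]
    have p3 : 1 - r ^ 2 ≠ 0 := (hr2 r hr').ne'
    have h := ((((hasDerivAt_id r).const_add 1).log p1).sub
      (((hasDerivAt_id r).const_sub 1).log p2)).sub ((hasDerivAt_id r).const_mul 2)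
    refine h.congr_deriv ?_
    simp only [id]
    have : 1 - r ^ 2 = (1 + r) * (1 - r) := by ring
    rw [this]
    field_simp
    ring
  have hci : IntervalIntegrable (fun r : ℝ => 2 / (1 - r ^ 2) - 2) volume a b := by
    refine ContinuousOn.intervalIntegrable ?_
    exact (ContinuousOn.div continuousOn_const (by fun_prop)
      fun r hr => (hr2 r (hsub hr)).ne').sub continuousOn_const
  rw [intervalIntegral.integral_eq_sub_of_hasDerivAt hA hci]
  have hart : ∀ r ∈ Icc a b, Real.log (1 + r) - Real.log (1 - r) = 2 * Real.artanh r := by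
    intro r hr
    rw [Real.artanh_eq_half_log ⟨by linarith [hr.1], by linarith [hr.2]⟩,
      Real.log_div (by linarith [hr.1]) (by linarith [hr.2])]
    ring
  rw [hart b ⟨hab.le, le_rfl⟩, hart a ⟨le_rfl, hab.le⟩, intervalIntegral.integral_const, smul_eq_mul,
    ← mul_div_assoc]
  refine div_le_div_of_nonneg_right ?_ hba.le
  -- The primitive is `2 artanh r - 2 r`; its linear part contributes `b - a`, which is below `1`.
  -- This is the origin of the `-1` in the bound.
  nlinarith [Real.pi_pos]

end PoincareDisk

/-! ### The Laplace-Beltrami operator under changes of plane coordinates. -/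

namespace PlaneMetric

/-- Gram-Schmidt: the vector `E·i - F·1` is orthogonal to `1` and has squared length `E (E G - F²)`.
-/
theorem gram_pos {h : ℂ → ℂ →L[ℝ] ℂ →L[ℝ] ℝ} {z : ℂ} (hsymm : ∀ v w, h z v w = h z w v)
    (hpos : ∀ v, v ≠ 0 → 0 < h z v v) : 0 < gram h z := by
  have hE : 0 < coeffE h z := hpos 1 one_ne_zero
  have hne : coeffE h z • Complex.I - coeffF h z • (1 : ℂ) ≠ 0 := by
    intro h0
    have := congrArg Complex.im h0
    simp at this
    exact hE.ne' this
  have h1 := hpos _ hne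
  have h2 : h z (coeffE h z • Complex.I - coeffF h z • (1 : ℂ))
      (coeffE h z • Complex.I - coeffF h z • (1 : ℂ)) = coeffE h z * gram h z := by
    simp only [map_sub, map_smul, sub_apply, smul_apply, smul_eq_mul, hsymm Complex.I 1]
    simp only [gram, coeffE, coeffF, coeffG]
    ring
  rw [h2] at h1
  exact (mul_pos_iff_of_pos_left hE).1 h1

theorem apply_eq_dx_dy (u : ℂ → ℝ) (z v : ℂ) : fderiv ℝ u z v = v.re * dx u z + v.im * dy u z := by
  have : v = v.re • (1 : ℂ) + v.im • Complex.I := by simp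
  conv_lhs => rw [this]
  simp only [map_add, map_smul, smul_eq_mul, dx, dy]

/-- The first component of `√(E G - F²) grad u`. -/
def gradX (h : ℂ → ℂ →L[ℝ] ℂ →L[ℝ] ℝ) (u : ℂ → ℝ) (w : ℂ) : ℝ :=
  (coeffG h w * dx u w - coeffF h w * dy u w) / √(gram h w)

/-- The second component of `√(E G - F²) grad u`. -/
def gradY (h : ℂ → ℂ →L[ℝ] ℂ →L[ℝ] ℝ) (u : ℂ → ℝ) (w : ℂ) : ℝ :=
  (coeffE h w * dy u w - coeffF h w * dx u w) / √(gram h w)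

theorem laplacian_eq (h : ℂ → ℂ →L[ℝ] ℂ →L[ℝ] ℝ) (u : ℂ → ℝ) (z : ℂ) :
    laplacian h u z = (dx (gradX h u) z + dy (gradY h u) z) / √(gram h z) := rfl

section Coordinates

variable {k : ℂ → ℂ →L[ℝ] ℂ →L[ℝ] ℝ} {u : ℂ → ℝ} {w : ℂ}

theorem contDiffAt_apply_apply (hk : ContDiffAt ℝ 1 k w) (v v' : ℂ) :
    ContDiffAt ℝ 1 (fun w => k w v v') w :=
  (hk.clm_apply contDiffAt_const).clm_apply contDiffAt_const

theorem contDiffAt_gram (hk : ContDiffAt ℝ 1 k w) : ContDiffAt ℝ 1 (gram k) w :=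
  ((contDiffAt_apply_apply hk _ _).mul (contDiffAt_apply_apply hk _ _)).sub
    ((contDiffAt_apply_apply hk _ _).pow 2)

theorem contDiffAt_fderiv_apply (hu : ContDiffAt ℝ 2 u w) (v : ℂ) :
    ContDiffAt ℝ 1 (fun w => fderiv ℝ u w v) w :=
  (hu.fderiv_right (m := 1) (by norm_num)).clm_apply contDiffAt_const

theorem contDiffAt_gradX (hk : ContDiffAt ℝ 1 k w) (hu : ContDiffAt ℝ 2 u w) (hg : 0 < gram k w) :
    ContDiffAt ℝ 1 (gradX k u) w :=
  (((contDiffAt_apply_apply hk _ _).mul (contDiffAt_fderiv_apply hu _)).sub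
    ((contDiffAt_apply_apply hk _ _).mul (contDiffAt_fderiv_apply hu _))).div
    ((contDiffAt_gram hk).sqrt hg.ne') (Real.sqrt_pos.2 hg).ne'

theorem contDiffAt_gradY (hk : ContDiffAt ℝ 1 k w) (hu : ContDiffAt ℝ 2 u w) (hg : 0 < gram k w) :
    ContDiffAt ℝ 1 (gradY k u) w :=
  (((contDiffAt_apply_apply hk _ _).mul (contDiffAt_fderiv_apply hu _)).sub
    ((contDiffAt_apply_apply hk _ _).mul (contDiffAt_fderiv_apply hu _))).div
    ((contDiffAt_gram hk).sqrt hg.ne') (Real.sqrt_pos.2 hg).ne'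

/-- The Jacobian determinant of a map of the plane. -/
def jacobian (a : ℂ → ℂ) (z : ℂ) : ℝ :=
  (fderiv ℝ a z 1).re * (fderiv ℝ a z Complex.I).im -
    (fderiv ℝ a z Complex.I).re * (fderiv ℝ a z 1).im

/-- The Laplace-Beltrami operator is invariant under changes of coordinates. -/
theorem laplacian_comp {h : ℂ → ℂ →L[ℝ] ℂ →L[ℝ] ℝ} {a : ℂ → ℂ} {u' : ℂ → ℝ} {z : ℂ}
    (ha : ContDiffAt ℝ 2 a z) (hk : ContDiffAt ℝ 1 k (a z)) (hu : ContDiffAt ℝ 2 u (a z))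
    (hsymm : ∀ᶠ w in 𝓝 (a z), ∀ v v', k w v v' = k w v' v)
    (hgk : 0 < gram k (a z)) (hgh : 0 < gram h z)
    (hpull : ∀ᶠ y in 𝓝 z, ∀ v v', h y v v' = k (a y) (fderiv ℝ a y v) (fderiv ℝ a y v'))
    (hu' : u' =ᶠ[𝓝 z] fun y => u (a y)) :
    laplacian h u' z = laplacian k u (a z) := by
  have hac : Tendsto a (𝓝 z) (𝓝 (a z)) := ha.continuousAt
  have hDa : ContDiffAt ℝ 1 (fderiv ℝ a) z := ha.fderiv_right (m := 1) (by norm_num)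
  set P : ℂ → ℝ := fun y => (fderiv ℝ a y 1).re with hP
  set Q : ℂ → ℝ := fun y => (fderiv ℝ a y Complex.I).re with hQ
  set R : ℂ → ℝ := fun y => (fderiv ℝ a y 1).im with hR
  set S : ℂ → ℝ := fun y => (fderiv ℝ a y Complex.I).im with hS
  have d1 (y : ℂ) : fderiv ℝ a y 1 = P y • (1 : ℂ) + R y • Complex.I := by simp [hP, hR]
  have dI (y : ℂ) : fderiv ℝ a y Complex.I = Q y • (1 : ℂ) + S y • Complex.I := by simp [hQ, hS]
  have hJ (y : ℂ) : jacobian a y = P y * S y - Q y * R y := rfl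
  -- first-order data near `z`
  have hcoef : ∀ᶠ y in 𝓝 z,
      coeffE h y = P y ^ 2 * coeffE k (a y) + 2 * P y * R y * coeffF k (a y)
        + R y ^ 2 * coeffG k (a y) ∧
      coeffF h y = P y * Q y * coeffE k (a y) + (P y * S y + Q y * R y) * coeffF k (a y)
        + R y * S y * coeffG k (a y) ∧
      coeffG h y = Q y ^ 2 * coeffE k (a y) + 2 * Q y * S y * coeffF k (a y)
        + S y ^ 2 * coeffG k (a y) := by
    filter_upwards [hpull, hac.eventually hsymm] with y hy hs
    simp only [coeffE, coeffF, coeffG, hy, d1, dI, map_add, map_smul, add_apply,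
      smul_apply, smul_eq_mul, hs Complex.I 1]
    refine ⟨by ring, by ring, by ring⟩
  have hgram : ∀ᶠ y in 𝓝 z, gram h y = jacobian a y ^ 2 * gram k (a y) := by
    filter_upwards [hcoef] with y ⟨h1, h2, h3⟩
    rw [hJ, gram, gram, h1, h2, h3]; ring
  have hJz : jacobian a z ≠ 0 := by
    intro h0
    rw [hgram.self_of_nhds, h0] at hgh
    simp at hgh
  have hPd (v : ℂ) : HasFDerivAt (fun y => fderiv ℝ a y v)
      ((fderiv ℝ (fderiv ℝ a) z).flip v) z := by
    have := (hDa.differentiableAt one_ne_zero).hasFDerivAt.clm_apply (hasFDerivAt_const v z)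
    simpa using this
  have hre (v : ℂ) : HasFDerivAt (fun y => (fderiv ℝ a y v).re)
      (Complex.reCLM.comp ((fderiv ℝ (fderiv ℝ a) z).flip v)) z :=
    Complex.reCLM.hasFDerivAt.comp z (hPd v)
  have him (v : ℂ) : HasFDerivAt (fun y => (fderiv ℝ a y v).im)
      (Complex.imCLM.comp ((fderiv ℝ (fderiv ℝ a) z).flip v)) z :=
    Complex.imCLM.hasFDerivAt.comp z (hPd v)
  have hJc : ContinuousAt (jacobian a) z :=
    ((hre 1).continuousAt.mul (him _).continuousAt).sub ((hre _).continuousAt.mul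
      (him _).continuousAt)
  -- The change of coordinates may reverse orientation, and `√(J²) = |J|`. The sign is locally
  -- constant, so it passes through derivatives as a scalar.
  set σ := SignType.sign (jacobian a z) with hσ
  have hsign : ∀ᶠ y in 𝓝 z, SignType.sign (jacobian a y) = σ := by
    rcases hJz.lt_or_gt with h0 | h0
    · filter_upwards [hJc.eventually_lt_const h0] with y hy
      rw [hσ, sign_neg hy, sign_neg h0]
    · filter_upwards [hJc.eventually_const_lt h0] with y hy
      rw [hσ, sign_pos hy, sign_pos h0]
  have hgk' : ∀ᶠ y in 𝓝 z, 0 < gram k (a y) :=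
    hac.eventually ((contDiffAt_gram hk).continuousAt.eventually_const_lt hgk)
  have hdu : ∀ᶠ y in 𝓝 z, dx u' y = P y * dx u (a y) + R y * dy u (a y) ∧
      dy u' y = Q y * dx u (a y) + S y * dy u (a y) := by
    have e1 : ∀ᶠ y in 𝓝 z, DifferentiableAt ℝ a y :=
      (ha.eventually (by simp)).mono fun y hy => hy.differentiableAt two_ne_zero
    have e2 : ∀ᶠ y in 𝓝 z, DifferentiableAt ℝ u (a y) :=
      (hac.eventually (hu.eventually (by simp))).mono fun y hy => hy.differentiableAt two_ne_zero
    filter_upwards [hu'.fderiv (𝕜 := ℝ), e1, e2] with y hy h1 h2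
    have hc : fderiv ℝ u' y = (fderiv ℝ u (a y)).comp (fderiv ℝ a y) :=
      hy.trans (fderiv_comp y h2 h1)
    constructor
    · rw [dx, hc, ContinuousLinearMap.comp_apply, apply_eq_dx_dy]
    · rw [dy, hc, ContinuousLinearMap.comp_apply, apply_eq_dx_dy]
  -- The field `√(E G - F²) grad u` is a vector density: it pulls back by the adjugate of the
  -- Jacobian matrix, up to the sign `σ`.
  have hX : gradX h u' =ᶠ[𝓝 z]
      fun y => (σ : ℝ) * (S y * gradX k u (a y) - Q y * gradY k u (a y)) := by
    filter_upwards [hcoef, hgram, hsign, hgk', hdu, hJc.eventually_ne hJz] with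
      y ⟨h1, h2, h3⟩ h4 h5 h6 ⟨h7, h8⟩ h9
    have h10 := Real.sqrt_pos.2 h6
    have h11 : (σ : ℝ) * |jacobian a y| = P y * S y - Q y * R y := h5 ▸ sign_mul_abs _
    have h13 : |jacobian a y| ≠ 0 := abs_ne_zero.2 h9
    rw [gradX, gradX, gradY, h4, h2, h3, h7, h8, Real.sqrt_mul (sq_nonneg _), Real.sqrt_sq_eq_abs]
    field_simp
    linear_combination (-(S y * (coeffG k (a y) * dx u (a y) - coeffF k (a y) * dy u (a y)) -
      Q y * (coeffE k (a y) * dy u (a y) - coeffF k (a y) * dx u (a y)))) * h11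
  have hY : gradY h u' =ᶠ[𝓝 z]
      fun y => (σ : ℝ) * (P y * gradY k u (a y) - R y * gradX k u (a y)) := by
    filter_upwards [hcoef, hgram, hsign, hgk', hdu, hJc.eventually_ne hJz] with
      y ⟨h1, h2, h3⟩ h4 h5 h6 ⟨h7, h8⟩ h9
    have h10 := Real.sqrt_pos.2 h6
    have h11 : (σ : ℝ) * |jacobian a y| = P y * S y - Q y * R y := h5 ▸ sign_mul_abs _
    have h13 : |jacobian a y| ≠ 0 := abs_ne_zero.2 h9
    rw [gradY, gradX, gradY, h4, h1, h2, h7, h8, Real.sqrt_mul (sq_nonneg _), Real.sqrt_sq_eq_abs]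
    field_simp
    linear_combination (-(P y * (coeffE k (a y) * dy u (a y) - coeffF k (a y) * dx u (a y)) -
      R y * (coeffG k (a y) * dx u (a y) - coeffF k (a y) * dy u (a y)))) * h11
  have hσJ : (σ : ℝ) * jacobian a z = |jacobian a z| := by
    rw [hσ]
    exact sign_mul_self _
  have hL1 := ((contDiffAt_gradX hk hu hgk).differentiableAt one_ne_zero).hasFDerivAt.comp z
    (ha.differentiableAt two_ne_zero).hasFDerivAt
  have hL2 := ((contDiffAt_gradY hk hu hgk).differentiableAt one_ne_zero).hasFDerivAt.comp z
    (ha.differentiableAt two_ne_zero).hasFDerivAt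
  have hXd := ((((him Complex.I).mul hL1).sub ((hre Complex.I).mul hL2)).const_mul (σ : ℝ)).fderiv
  have hYd := ((((hre 1).mul hL2).sub ((him 1).mul hL1)).const_mul (σ : ℝ)).fderiv
  -- Equality of mixed derivatives makes the rows of the cofactor matrix divergence free (the Piola
  -- identity), so no second derivative of `a` survives in the divergence.
  have hsymm2 : fderiv ℝ (fderiv ℝ a) z 1 Complex.I = fderiv ℝ (fderiv ℝ a) z Complex.I 1 :=
    ha.isSymmSndFDerivAt (by simp) 1 Complex.I
  rw [laplacian_eq, laplacian_eq]
  have hxx : dx (gradX h u') z + dy (gradY h u') z =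
      |jacobian a z| * (dx (gradX k u) (a z) + dy (gradY k u) (a z)) := by
    have e1 : dx (gradX h u') z = _ := (congrArg (· 1) (hX.fderiv_eq.trans hXd))
    have e2 : dy (gradY h u') z = _ := (congrArg (· Complex.I) (hY.fderiv_eq.trans hYd))
    rw [e1, e2, ← hσJ, hJ]
    simp only [smul_apply, sub_apply, add_apply, smul_eq_mul, ContinuousLinearMap.comp_apply,
      ContinuousLinearMap.flip_apply, apply_eq_dx_dy, hsymm2, Complex.reCLM_apply,
      Complex.imCLM_apply, Function.comp]
    simp only [hP, hQ, hR, hS]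
    ring
  rw [hxx, hgram.self_of_nhds, Real.sqrt_mul (sq_nonneg _), Real.sqrt_sq_eq_abs,
    mul_div_mul_left _ _ (abs_ne_zero.2 hJz)]

end Coordinates

/-- The Laplacian of a conformal metric. -/
theorem laplacian_conformal {h : ℂ → ℂ →L[ℝ] ℂ →L[ℝ] ℝ} {u : ℂ → ℝ} {z : ℂ} {c : ℂ → ℝ}
    (hc : ∀ᶠ y in 𝓝 z, 0 < c y) (hh : ∀ᶠ y in 𝓝 z, ∀ v w, h y v w = c y * inner ℝ v w) :
    laplacian h u z = (dx (dx u) z + dy (dy u) z) / c z := by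
  have hcoef : ∀ᶠ y in 𝓝 z, coeffE h y = c y ∧ coeffF h y = 0 ∧ coeffG h y = c y ∧
      √(gram h y) = c y := by
    filter_upwards [hc, hh] with y h0 hy
    have h1 : coeffE h y = c y := by simp [coeffE, hy]
    have h2 : coeffF h y = 0 := by simp [coeffF, hy, Complex.inner]
    have h3 : coeffG h y = c y := by simp [coeffG, hy]
    refine ⟨h1, h2, h3, ?_⟩
    rw [gram, h1, h2, h3]
    rw [show c y * c y - 0 ^ 2 = c y ^ 2 by ring, Real.sqrt_sq h0.le]
  have hX : gradX h u =ᶠ[𝓝 z] dx u := by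
    filter_upwards [hcoef, hc] with y ⟨h1, h2, h3, h4⟩ h0
    rw [gradX, h2, h3, h4]
    field_simp
    ring
  have hY : gradY h u =ᶠ[𝓝 z] dy u := by
    filter_upwards [hcoef, hc] with y ⟨h1, h2, h3, h4⟩ h0
    rw [gradY, h1, h2, h4]
    field_simp
    ring
  rw [laplacian_eq, hcoef.self_of_nhds.2.2.2]
  unfold dx dy at *
  rw [hX.fderiv_eq, hY.fderiv_eq]

end PlaneMetric

/-! ### The leafwise Laplacian in foliated charts. -/

namespace SurfaceFoliation

theorem eventually_slice_mem_target {q : ℕ} {M : Type*} [TopologicalSpace M]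
    {φ : OpenPartialHomeomorph M (ℂ × EuclideanSpace ℝ (Fin q))}
    {p : ℂ × EuclideanSpace ℝ (Fin q)} (hp : p ∈ φ.target) :
    ∀ᶠ z in 𝓝 p.1, (z, p.2) ∈ φ.target :=
  (by fun_prop : Continuous fun z : ℂ => (z, p.2)).continuousAt.eventually
    (φ.open_target.mem_nhds hp)

variable {q : ℕ} {M : Type*} [TopologicalSpace M]
  [ChartedSpace (EuclideanSpace ℝ (Fin (q + 2))) M]

theorem two_le_infty : (2 : WithTop ℕ∞) ≤ ∞ := by
  exact WithTop.coe_le_coe.2 (le_top : (2 : ℕ∞) ≤ ⊤)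

theorem chart_mem_atlas (F : SurfaceFoliation q M) (x : M) : F.chart x ∈ F.atlas :=
  (F.exists_chart x).choose_spec.1

theorem mem_chart_source (F : SurfaceFoliation q M) (x : M) : x ∈ (F.chart x).source :=
  (F.exists_chart x).choose_spec.2

theorem contDiffAt_transition (F : SurfaceFoliation q M)
    {φ ψ : OpenPartialHomeomorph M (ℂ × EuclideanSpace ℝ (Fin q))} (hφ : φ ∈ F.atlas)
    (hψ : ψ ∈ F.atlas) {p : ℂ × EuclideanSpace ℝ (Fin q)} (hp : p ∈ (φ.symm.trans ψ).source) :
    ContDiffAt ℝ ∞ (fun p => ψ (φ.symm p)) p := by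
  rw [OpenPartialHomeomorph.trans_source, OpenPartialHomeomorph.symm_source] at hp
  rw [← contMDiffAt_iff_contDiffAt]
  exact ((F.smooth ψ hψ).contMDiffAt (ψ.open_source.mem_nhds hp.2)).comp p
    ((F.smooth_symm φ hφ).contMDiffAt (φ.open_target.mem_nhds hp.1))

theorem contDiffAt_comp_chart_symm (F : SurfaceFoliation q M)
    {φ : OpenPartialHomeomorph M (ℂ × EuclideanSpace ℝ (Fin q))} (hφ : φ ∈ F.atlas) {f : M → ℝ}
    (hf : ContMDiff (𝓡 (q + 2)) 𝓘(ℝ, ℝ) 2 f) {p : ℂ × EuclideanSpace ℝ (Fin q)}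
    (hp : p ∈ φ.target) : ContDiffAt ℝ 2 (fun p => f (φ.symm p)) p := by
  rw [← contMDiffAt_iff_contDiffAt]
  exact (hf _).comp p (((F.smooth_symm φ hφ).contMDiffAt (φ.open_target.mem_nhds hp)).of_le
    two_le_infty)

theorem isOpen_plaque (F : SurfaceFoliation q M)
    {φ : OpenPartialHomeomorph M (ℂ × EuclideanSpace ℝ (Fin q))} (hφ : φ ∈ F.atlas) {U : Set ℂ}
    (hU : IsOpen U) (t : EuclideanSpace ℝ (Fin q)) :
    IsOpen[F.leafTopology] (φ.source ∩ φ ⁻¹' (U ×ˢ {t})) :=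
  TopologicalSpace.isOpen_generateFrom_of_mem ⟨φ, hφ, U, hU, t, rfl⟩

namespace LeafMetric

variable {F : SurfaceFoliation q M} (g : F.LeafMetric)

/-- The leafwise Laplacian computed in a given foliated chart. -/
def chartLaplacian (φ : OpenPartialHomeomorph M (ℂ × EuclideanSpace ℝ (Fin q))) (f : M → ℝ)
    (p : ℂ × EuclideanSpace ℝ (Fin q)) : ℝ :=
  PlaneMetric.laplacian (fun z => g.coeff φ (z, p.2)) (fun z => f (φ.symm (z, p.2))) p.1

variable {φ ψ : OpenPartialHomeomorph M (ℂ × EuclideanSpace ℝ (Fin q))} {f : M → ℝ}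
  {p : ℂ × EuclideanSpace ℝ (Fin q)}

theorem contDiffAt_coeff (hφ : φ ∈ F.atlas) (hp : p ∈ φ.target) :
    ContDiffAt ℝ ∞ (g.coeff φ) p :=
  (g.smooth φ hφ).contDiffAt (φ.open_target.mem_nhds hp)

theorem contDiffAt_coeff_slice (hφ : φ ∈ F.atlas) (hp : p ∈ φ.target) :
    ContDiffAt ℝ 1 (fun z => g.coeff φ (z, p.2)) p.1 :=
  ((g.contDiffAt_coeff hφ hp).of_le (by exact_mod_cast le_top)).comp (f := fun z => (z, p.2)) p.1
    (contDiffAt_id.prodMk contDiffAt_const)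

theorem contDiffAt_comp_chart_symm_slice (hφ : φ ∈ F.atlas)
    (hf : ContMDiff (𝓡 (q + 2)) 𝓘(ℝ, ℝ) 2 f) (hp : p ∈ φ.target) :
    ContDiffAt ℝ 2 (fun z => f (φ.symm (z, p.2))) p.1 :=
  (F.contDiffAt_comp_chart_symm hφ hf hp).comp (f := fun z => (z, p.2)) p.1
    (contDiffAt_id.prodMk contDiffAt_const)

theorem gram_slice_pos (hφ : φ ∈ F.atlas) (hp : p ∈ φ.target) :
    0 < PlaneMetric.gram (fun z => g.coeff φ (z, p.2)) p.1 :=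
  PlaneMetric.gram_pos (g.symm φ hφ p hp) (g.pos φ hφ p hp)

theorem eventually_symm_slice (hφ : φ ∈ F.atlas) (hp : p ∈ φ.target) :
    ∀ᶠ z in 𝓝 p.1, ∀ v w, g.coeff φ (z, p.2) v w = g.coeff φ (z, p.2) w v :=
  (eventually_slice_mem_target hp).mono fun _ hz => g.symm φ hφ _ hz

/-- The leafwise Laplacian does not depend on the foliated chart. -/
theorem chartLaplacian_transition (hφ : φ ∈ F.atlas) (hψ : ψ ∈ F.atlas)
    (hf : ContMDiff (𝓡 (q + 2)) 𝓘(ℝ, ℝ) 2 f) (hp : p ∈ (φ.symm.trans ψ).source) :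
    g.chartLaplacian φ f p = g.chartLaplacian ψ f (ψ (φ.symm p)) := by
  set τ := fun p => ψ (φ.symm p) with hτ
  have hp' := hp
  rw [OpenPartialHomeomorph.trans_source, OpenPartialHomeomorph.symm_source] at hp'
  have hτp : τ p ∈ ψ.target := ψ.map_source hp'.2
  have hslice : Tendsto (fun z : ℂ => (z, p.2)) (𝓝 p.1) (𝓝 p) :=
    (by fun_prop : Continuous fun z : ℂ => (z, p.2)).continuousAt
  have hsrc : ∀ᶠ z in 𝓝 p.1, (z, p.2) ∈ (φ.symm.trans ψ).source :=
    hslice.eventually ((φ.symm.trans ψ).open_source.mem_nhds hp)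
  -- Transitions send plaques to plaques, so on a slice they reduce to a map of the plane with fixed
  -- transverse coordinate.
  have hplaque : ∀ᶠ z in 𝓝 p.1, (τ (z, p.2)).2 = (τ p).2 := by
    obtain ⟨U, hU, h⟩ := F.plaque φ hφ ψ hψ p hp
    filter_upwards [hslice.eventually hU] with z hz
    exact h _ hz p (mem_of_mem_nhds hU) rfl
  have hτz : ∀ᶠ z in 𝓝 p.1, ((τ (z, p.2)).1, (τ p).2) = τ (z, p.2) := by
    filter_upwards [hplaque] with z hz
    rw [← hz]
  refine PlaneMetric.laplacian_comp (a := fun z => (τ (z, p.2)).1) ?_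
    (g.contDiffAt_coeff_slice hψ hτp) (contDiffAt_comp_chart_symm_slice hψ hf hτp)
    (g.eventually_symm_slice hψ hτp) (g.gram_slice_pos hψ hτp) (g.gram_slice_pos hφ hp'.1) ?_ ?_
  · exact (((F.contDiffAt_transition hφ hψ hp).comp (f := fun z => (z, p.2)) p.1
      (contDiffAt_id.prodMk contDiffAt_const)).fst).of_le two_le_infty
  · filter_upwards [hsrc, hτz] with z hz hz'
    intro v w
    have hd : ∀ v, fderiv ℝ (fun z => (τ (z, p.2)).1) z v = (fderiv ℝ τ (z, p.2) (v, 0)).1 := by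
      intro v
      have h1 : HasFDerivAt τ (fderiv ℝ τ (z, p.2)) (z, p.2) :=
        ((F.contDiffAt_transition hφ hψ hz).differentiableAt (by simp)).hasFDerivAt
      have h2 : HasFDerivAt (fun z => τ (z, p.2)) _ z :=
        h1.comp (f := fun z => (z, p.2)) z ((hasFDerivAt_id z).prodMk (hasFDerivAt_const p.2 z))
      rw [h2.fst.fderiv]
      rfl
    rw [hz', hd, hd]
    exact g.compat φ hφ ψ hψ _ hz v w
  · filter_upwards [hsrc, hτz] with z hz hz'
    rw [hz', ψ.left_inv]
    exact hz.2

theorem leafLaplacian_eq_chartLaplacian (hφ : φ ∈ F.atlas)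
    (hf : ContMDiff (𝓡 (q + 2)) 𝓘(ℝ, ℝ) 2 f) {x : M} (hx : x ∈ φ.source) :
    g.leafLaplacian f x = g.chartLaplacian φ f (φ x) := by
  have h := g.chartLaplacian_transition (F.chart_mem_atlas x) hφ hf (p := F.chart x x)
    (by
      rw [OpenPartialHomeomorph.trans_source, OpenPartialHomeomorph.symm_source]
      refine ⟨(F.chart x).map_source (F.mem_chart_source x), ?_⟩
      rwa [mem_preimage, (F.chart x).left_inv (F.mem_chart_source x)])
  rw [(F.chart x).left_inv (F.mem_chart_source x)] at h
  exact h

theorem fderiv_slice {w : ℂ × EuclideanSpace ℝ (Fin q) → ℝ} (hw : DifferentiableAt ℝ w p) (v : ℂ) :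
    fderiv ℝ (fun z => w (z, p.2)) p.1 v = fderiv ℝ w p (v, 0) := by
  have h : HasFDerivAt (fun z => w (z, p.2)) _ p.1 :=
    (hw.hasFDerivAt (x := (p.1, p.2))).comp (f := fun z => (z, p.2)) p.1
      ((hasFDerivAt_id p.1).prodMk (hasFDerivAt_const p.2 p.1))
  rw [h.fderiv]
  rfl

/-- The operator differentiates with the transverse coordinate frozen, but continuity is wanted in
all variables. Slice derivatives are therefore rewritten as total derivatives in the directions `(1,
0)` and `(i, 0)`, applied to jointly `C¹` functions. -/
theorem continuousOn_chartLaplacian (hφ : φ ∈ F.atlas)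
    (hf : ContMDiff (𝓡 (q + 2)) 𝓘(ℝ, ℝ) 2 f) :
    ContinuousOn (g.chartLaplacian φ f) φ.target := by
  set T := φ.target
  have hT : IsOpen T := φ.open_target
  set w : ℂ × EuclideanSpace ℝ (Fin q) → ℝ := fun p => f (φ.symm p)
  have hw : ContDiffOn ℝ 2 w T := fun p hp =>
    (F.contDiffAt_comp_chart_symm hφ hf hp).contDiffWithinAt
  have hk (v v' : ℂ) : ContDiffOn ℝ 1 (fun p => g.coeff φ p v v') T :=
    (((g.smooth φ hφ).of_le (by exact_mod_cast le_top)).clm_apply contDiffOn_const).clm_apply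
      contDiffOn_const
  have hdw (v : ℂ) : ContDiffOn ℝ 1 (fun p => fderiv ℝ w p (v, 0)) T :=
    (hw.fderiv_of_isOpen hT (m := 1) (by norm_num)).clm_apply contDiffOn_const
  set D : ℂ × EuclideanSpace ℝ (Fin q) → ℝ := fun p =>
    PlaneMetric.gram (fun z => g.coeff φ (z, p.2)) p.1
  have hDpos : ∀ p ∈ T, 0 < D p := fun p hp => g.gram_slice_pos hφ hp
  have hD : ContDiffOn ℝ 1 (fun p => √(D p)) T :=
    (((hk _ _).mul (hk _ _)).sub ((hk _ _).pow 2)).sqrt (fun p hp => (hDpos p hp).ne')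
  have hD0 : ∀ p ∈ T, √(D p) ≠ 0 := fun p hp => (Real.sqrt_pos.2 (hDpos p hp)).ne'
  set X : ℂ × EuclideanSpace ℝ (Fin q) → ℝ := fun p =>
    (g.coeff φ p Complex.I Complex.I * fderiv ℝ w p (1, 0) -
      g.coeff φ p 1 Complex.I * fderiv ℝ w p (Complex.I, 0)) / √(D p)
  set Y : ℂ × EuclideanSpace ℝ (Fin q) → ℝ := fun p =>
    (g.coeff φ p 1 1 * fderiv ℝ w p (Complex.I, 0) -
      g.coeff φ p 1 Complex.I * fderiv ℝ w p (1, 0)) / √(D p)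
  have hX : ContDiffOn ℝ 1 X T := (((hk _ _).mul (hdw _)).sub ((hk _ _).mul (hdw _))).div hD hD0
  have hY : ContDiffOn ℝ 1 Y T := (((hk _ _).mul (hdw _)).sub ((hk _ _).mul (hdw _))).div hD hD0
  have hdiff {n : WithTop ℕ∞} (hn : n ≠ 0) {w : ℂ × EuclideanSpace ℝ (Fin q) → ℝ}
      (hw : ContDiffOn ℝ n w T) {p} (hp : p ∈ T) : DifferentiableAt ℝ w p :=
    (hw.contDiffAt (hT.mem_nhds hp)).differentiableAt hn
  have hmain : ∀ p ∈ T, g.chartLaplacian φ f p =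
      (fderiv ℝ X p (1, 0) + fderiv ℝ Y p (Complex.I, 0)) / √(D p) := by
    intro p hp
    have hev := eventually_slice_mem_target (φ := φ) hp
    have hdw' : ∀ᶠ z in 𝓝 p.1, ∀ v, fderiv ℝ (fun z => w (z, p.2)) z v =
        fderiv ℝ w (z, p.2) (v, 0) := by
      filter_upwards [hev] with z hz v
      exact fderiv_slice (p := (z, p.2)) (hdiff two_ne_zero hw hz) v
    have hXe : PlaneMetric.gradX (fun z => g.coeff φ (z, p.2)) (fun z => w (z, p.2)) =ᶠ[𝓝 p.1]
        fun z => X (z, p.2) := by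
      filter_upwards [hdw'] with z hz
      simp only [PlaneMetric.gradX, PlaneMetric.dx, PlaneMetric.dy, hz]
      rfl
    have hYe : PlaneMetric.gradY (fun z => g.coeff φ (z, p.2)) (fun z => w (z, p.2)) =ᶠ[𝓝 p.1]
        fun z => Y (z, p.2) := by
      filter_upwards [hdw'] with z hz
      simp only [PlaneMetric.gradY, PlaneMetric.dx, PlaneMetric.dy, hz]
      rfl
    rw [chartLaplacian, PlaneMetric.laplacian_eq, PlaneMetric.dx, PlaneMetric.dy, hXe.fderiv_eq,
      hYe.fderiv_eq, fderiv_slice (hdiff one_ne_zero hX hp), fderiv_slice (hdiff one_ne_zero hY hp)]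
  refine ContinuousOn.congr ?_ hmain
  exact (((hX.continuousOn_fderiv_of_isOpen hT le_rfl).clm_apply continuousOn_const).add
    ((hY.continuousOn_fderiv_of_isOpen hT le_rfl).clm_apply continuousOn_const)).div
    hD.continuousOn hD0

/-- The definition picks a chart separately at each point; independence of the chart allows one
chart to serve near `x`. -/
theorem continuous_leafLaplacian (hf : ContMDiff (𝓡 (q + 2)) 𝓘(ℝ, ℝ) 2 f) :
    Continuous (g.leafLaplacian f) := by
  rw [continuous_iff_continuousAt]
  intro x
  have hφ := F.chart_mem_atlas x
  have hx := F.mem_chart_source x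
  have h : g.leafLaplacian f =ᶠ[𝓝 x] fun y => g.chartLaplacian (F.chart x) f (F.chart x y) := by
    filter_upwards [(F.chart x).open_source.mem_nhds hx] with y hy
    exact g.leafLaplacian_eq_chartLaplacian hφ hf hy
  refine ContinuousAt.congr ?_ h.symm
  exact ContinuousAt.comp ((g.continuousOn_chartLaplacian hφ hf).continuousAt
    ((F.chart x).open_target.mem_nhds ((F.chart x).map_source hx)))
    ((F.chart x).continuousAt hx)

/-! ### Uniformizations: regularity and the Laplacian on the disk. -/

namespace IsLeafUniformization

variable {g} {x : M} {j : ℂ → M}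

/-- Locally a uniformization takes values in a plaque. -/
theorem eventually_mem_plaque (hj : g.IsLeafUniformization x j) (hφ : φ ∈ F.atlas) {z : ℂ}
    (hz : z ∈ Metric.ball (0 : ℂ) 1) (hjz : j z ∈ φ.source) {U : Set ℂ} (hU : IsOpen U)
    (hzU : (φ (j z)).1 ∈ U) :
    ∀ᶠ y in 𝓝 z, j y ∈ φ.source ∧ (φ (j y)).1 ∈ U ∧ (φ (j y)).2 = (φ (j z)).2 := by
  obtain ⟨p, hp, hpj⟩ := hj.covering
  -- Plaques are open in the leaf topology, for which the covering map is continuous; this is what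
  -- fixes the transverse coordinate near `z`.
  have hs := F.isOpen_plaque hφ hU (φ (j z)).2
  have h1 : IsOpen (p ⁻¹' (Subtype.val ⁻¹' (φ.source ∩ φ ⁻¹' (U ×ˢ {(φ (j z)).2})))) :=
    hp.continuous.isOpen_preimage _ (isOpen_induced (t := F.leafTopology) hs)
  have h2 := Metric.isOpen_ball.isOpenMap_subtype_val _ h1
  filter_upwards [h2.mem_nhds ⟨⟨z, hz⟩, ⟨by rwa [hpj], by rw [hpj]; exact ⟨hzU, rfl⟩⟩, rfl⟩]
  rintro _ ⟨y, ⟨hy1, hy2⟩, rfl⟩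
  rw [hpj] at hy1
  rw [mem_preimage, hpj] at hy2
  exact ⟨hy1, hy2.1, hy2.2⟩

/-- The covering hypothesis only concerns the leaf topology. Continuity into `M` follows because an
open set around `j z` contains a small piece of plaque around it. -/
theorem continuousAt (hj : g.IsLeafUniformization x j) {z : ℂ} (hz : z ∈ Metric.ball (0 : ℂ) 1) :
    ContinuousAt j z := by
  rw [ContinuousAt, (nhds_basis_opens (j z)).tendsto_right_iff]
  rintro V ⟨hzV, hV⟩
  set φ := F.chart (j z)
  have hs : j z ∈ φ.source := F.mem_chart_source _
  have hW : IsOpen (φ.target ∩ φ.symm ⁻¹' V) := φ.isOpen_inter_preimage_symm hV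
  have hU : IsOpen {y : ℂ | (y, (φ (j z)).2) ∈ φ.target ∩ φ.symm ⁻¹' V} :=
    hW.preimage (by fun_prop)
  filter_upwards [hj.eventually_mem_plaque (F.chart_mem_atlas _) hz hs hU
    ⟨φ.map_source hs, (congrArg (· ∈ V) (φ.left_inv hs)).mpr hzV⟩] with y ⟨h1, h2, h3⟩
  have h4 := h2.2
  rw [mem_preimage, ← h3, φ.left_inv h1] at h4
  exact h4

theorem contDiffAt_chart_fst (hj : g.IsLeafUniformization x j) (hφ : φ ∈ F.atlas) {z : ℂ}
    (hz : z ∈ Metric.ball (0 : ℂ) 1) (hjz : j z ∈ φ.source) :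
    ContDiffAt ℝ ∞ (fun z => (φ (j z)).1) z :=
  (hj.smooth φ hφ).contDiffAt (inter_mem (Metric.isOpen_ball.mem_nhds hz)
    ((hj.continuousAt hz).preimage_mem_nhds (φ.open_source.mem_nhds hjz)))

theorem comp_eventuallyEq (hj : g.IsLeafUniformization x j) (hφ : φ ∈ F.atlas) {z : ℂ}
    (hz : z ∈ Metric.ball (0 : ℂ) 1) (hjz : j z ∈ φ.source) (f : M → ℝ) :
    (fun y => f (j y)) =ᶠ[𝓝 z] fun y => f (φ.symm ((φ (j y)).1, (φ (j z)).2)) := by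
  filter_upwards [hj.eventually_mem_plaque hφ hz hjz isOpen_univ (mem_univ _)] with y ⟨h1, _, h3⟩
  rw [← h3, φ.left_inv h1]

theorem contDiffOn_comp (hj : g.IsLeafUniformization x j)
    (hf : ContMDiff (𝓡 (q + 2)) 𝓘(ℝ, ℝ) 2 f) :
    ContDiffOn ℝ 2 (fun z => f (j z)) (Metric.ball 0 1) := by
  intro z hz
  have hs := F.mem_chart_source (j z)
  have hφ := F.chart_mem_atlas (j z)
  refine ContDiffAt.contDiffWithinAt (ContDiffAt.congr_of_eventuallyEq ?_
    (hj.comp_eventuallyEq hφ hz hs f))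
  exact (contDiffAt_comp_chart_symm_slice hφ hf ((F.chart (j z)).map_source hs)).comp
    (f := fun y => (F.chart (j z) (j y)).1) z
    ((hj.contDiffAt_chart_fst hφ hz hs).of_le two_le_infty)

/-- The leafwise Laplacian in the uniformizing coordinate. -/
theorem leafLaplacian_comp (hj : g.IsLeafUniformization x j)
    (hf : ContMDiff (𝓡 (q + 2)) 𝓘(ℝ, ℝ) 2 f) {z : ℂ} (hz : z ∈ Metric.ball (0 : ℂ) 1) :
    g.leafLaplacian f (j z) =
      (PlaneMetric.dx (PlaneMetric.dx fun z => f (j z)) z +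
        PlaneMetric.dy (PlaneMetric.dy fun z => f (j z)) z) / (4 / (1 - ‖z‖ ^ 2) ^ 2) := by
  set φ := F.chart (j z) with hφdef
  have hs : j z ∈ φ.source := F.mem_chart_source (j z)
  have hφ : φ ∈ F.atlas := F.chart_mem_atlas (j z)
  have hp : φ (j z) ∈ φ.target := φ.map_source hs
  set h : ℂ → ℂ →L[ℝ] ℂ →L[ℝ] ℝ := fun y => (4 / (1 - ‖y‖ ^ 2) ^ 2) • innerSL ℝ
  have hh : ∀ y v w, h y v w = 4 / (1 - ‖y‖ ^ 2) ^ 2 * inner ℝ v w := fun _ _ _ => rfl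
  have hball : ∀ᶠ y in 𝓝 z, y ∈ Metric.ball (0 : ℂ) 1 := Metric.isOpen_ball.mem_nhds hz
  have hcpos : ∀ y ∈ Metric.ball (0 : ℂ) 1, 0 < 4 / (1 - ‖y‖ ^ 2) ^ 2 := by
    intro y hy
    rw [mem_ball_zero_iff] at hy
    have : 0 < 1 - ‖y‖ ^ 2 := by nlinarith [norm_nonneg y]
    positivity
  have hplaque := hj.eventually_mem_plaque hφ hz hs isOpen_univ (mem_univ _)
  -- The right side is the Laplacian of the Poincaré metric `h`. As `j` is a local isometry, its
  -- leaf coordinate is a change of coordinates pulling `g` back to `h`.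
  rw [← PlaneMetric.laplacian_conformal (h := h) (c := fun y => 4 / (1 - ‖y‖ ^ 2) ^ 2)
    (hball.mono hcpos) (Eventually.of_forall hh)]
  refine (PlaneMetric.laplacian_comp (a := fun y => (φ (j y)).1)
    ((hj.contDiffAt_chart_fst hφ hz hs).of_le two_le_infty)
    (g.contDiffAt_coeff_slice hφ hp) (contDiffAt_comp_chart_symm_slice hφ hf hp)
    (g.eventually_symm_slice hφ hp) (g.gram_slice_pos hφ hp) ?_ ?_
    (hj.comp_eventuallyEq hφ hz hs f)).symm
  · refine PlaneMetric.gram_pos (fun v w => ?_) (fun v hv => ?_)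
    · rw [hh, hh, real_inner_comm]
    · rw [hh]
      exact mul_pos (hcpos z hz) (real_inner_self_pos.2 hv)
  · filter_upwards [hball, hplaque] with y hy ⟨h1, _, h3⟩
    intro v w
    rw [hh, ← h3]
    exact (hj.isometry φ hφ y hy h1 v w).symm

end IsLeafUniformization

end LeafMetric

end SurfaceFoliation

/-! ### Averages against the normalized disk measures. -/

namespace PoincareDisk

variable {ρ ρ' : ℝ}

theorem tanh_lt_tanh {a b : ℝ} (h : a < b) : Real.tanh a < Real.tanh b := by
  have ha := Real.tanh_bijOn.mapsTo (mem_univ a)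
  have hb := Real.tanh_bijOn.mapsTo (mem_univ b)
  rw [← Real.artanh_lt_artanh_iff ha hb, Real.artanh_tanh, Real.artanh_tanh]
  exact h

theorem measurable_cutoff_mul_density (hρ' : 0 < ρ') :
    Measurable fun z => cutoff ρ ρ' z * (4 / (1 - ‖z‖ ^ 2) ^ 2) := by
  have : Measurable (cutoff ρ ρ') :=
    (continuous_radialCutoff (tanh_lt_tanh (by linarith))).measurable.comp measurable_norm
  fun_prop

theorem cutoff_mul_density_nonneg (hρ' : 0 < ρ') (z : ℂ) :
    0 ≤ cutoff ρ ρ' z * (4 / (1 - ‖z‖ ^ 2) ^ 2) :=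
  mul_nonneg (radialCutoff_nonneg (tanh_lt_tanh (by linarith)) _) (by positivity)

theorem cutoffVolume_univ (hρ' : 0 < ρ') :
    cutoffVolume ρ ρ' univ = ENNReal.ofReal
      (∫ z in Metric.ball (0 : ℂ) 1, cutoff ρ ρ' z * (4 / (1 - ‖z‖ ^ 2) ^ 2)) := by
  rw [cutoffVolume, withDensity_apply _ MeasurableSet.univ, Measure.restrict_univ,
    ofReal_integral_eq_lintegral_ofReal]
  · refine integrableOn_radialCutoff_mul (F := fun z => 4 / (1 - ‖z‖ ^ 2) ^ 2)
      (tanh_lt_tanh (by linarith)) (Real.tanh_lt_one _)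
      (ContinuousOn.div continuousOn_const (by fun_prop) fun z hz => ?_)
    rw [mem_ball_zero_iff] at hz
    have : 0 < 1 - ‖z‖ ^ 2 := by nlinarith [norm_nonneg z]
    positivity
  · exact Eventually.of_forall (cutoff_mul_density_nonneg hρ')

theorem integral_diskMeasure (hρ' : 0 < ρ') (F : ℂ → ℝ) :
    ∫ z, F z ∂diskMeasure ρ ρ' =
      (∫ z in Metric.ball (0 : ℂ) 1, cutoff ρ ρ' z * (4 / (1 - ‖z‖ ^ 2) ^ 2))⁻¹ *
        ∫ z in Metric.ball (0 : ℂ) 1, cutoff ρ ρ' z * (4 / (1 - ‖z‖ ^ 2) ^ 2) * F z := by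
  rw [diskMeasure, integral_smul_measure, cutoffVolume_univ hρ', ENNReal.toReal_inv,
    ENNReal.toReal_ofReal (integral_nonneg fun z => cutoff_mul_density_nonneg hρ' z), smul_eq_mul,
    cutoffVolume, integral_withDensity_eq_integral_toReal_smul
      (measurable_cutoff_mul_density hρ').ennreal_ofReal
      (Eventually.of_forall fun _ => ENNReal.ofReal_lt_top)]
  simp_rw [ENNReal.toReal_ofReal (cutoff_mul_density_nonneg hρ' _), smul_eq_mul]

/-- The averaging measures nearly annihilate hyperbolic Laplacians of bounded functions. -/
theorem abs_integral_diskMeasure_laplacian_le (hρ : 0 < ρ) (hρ' : 1 < ρ') {u : ℂ → ℝ} {C : ℝ}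
    (hu : ContDiffOn ℝ 2 u (Metric.ball 0 1)) (hC : ∀ z ∈ Metric.ball (0 : ℂ) 1, |u z| ≤ C)
    {F : ℂ → ℝ} (hF : ∀ z ∈ Metric.ball (0 : ℂ) 1,
      F z = (PlaneMetric.dx (PlaneMetric.dx u) z + PlaneMetric.dy (PlaneMetric.dy u) z) /
        (4 / (1 - ‖z‖ ^ 2) ^ 2)) :
    |∫ z, F z ∂diskMeasure ρ ρ'| ≤ C / (ρ' - 1) := by
  have hρ'0 : 0 < ρ' := one_pos.trans hρ'
  have hab : Real.tanh ρ < Real.tanh (ρ + ρ') := tanh_lt_tanh (by linarith)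
  have ha : 0 < Real.tanh ρ := by simpa using tanh_lt_tanh hρ
  have hb : Real.tanh (ρ + ρ') < 1 := Real.tanh_lt_one _
  have hd := sub_pos.2 hab
  have hA := le_setIntegral_radialCutoff_mul_density hab ha hb
  -- The radii are hyperbolic tangents, so the difference of `artanh` is exactly `ρ'`.
  rw [Real.artanh_tanh, Real.artanh_tanh, add_sub_cancel_left] at hA
  have hI := abs_setIntegral_radialCutoff_mul_laplacian_le hab ha hb hu hC
  -- Conformal invariance: the area density cancels the denominator of the hyperbolic Laplacian.
  have hint : ∫ z in Metric.ball (0 : ℂ) 1, cutoff ρ ρ' z * (4 / (1 - ‖z‖ ^ 2) ^ 2) * F z =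
      ∫ z in Metric.ball (0 : ℂ) 1, radialCutoff (Real.tanh ρ) (Real.tanh (ρ + ρ')) ‖z‖ *
        (PlaneMetric.dx (PlaneMetric.dx u) z + PlaneMetric.dy (PlaneMetric.dy u) z) := by
    refine setIntegral_congr_fun Metric.isOpen_ball.measurableSet fun z hz => ?_
    simp only [hF z hz]
    rw [mem_ball_zero_iff] at hz
    have : 0 < 1 - ‖z‖ ^ 2 := by nlinarith [norm_nonneg z]
    rw [cutoff_eq_radialCutoff]
    field_simp
  rw [integral_diskMeasure hρ'0, hint, abs_mul, abs_inv]
  have hpos : 0 < 4 * Real.pi * (ρ' - 1) / (Real.tanh (ρ + ρ') - Real.tanh ρ) :=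
    div_pos (mul_pos (by positivity) (by linarith)) hd
  calc _ ≤ (4 * Real.pi * (ρ' - 1) / (Real.tanh (ρ + ρ') - Real.tanh ρ))⁻¹ *
        (4 * Real.pi * C / (Real.tanh (ρ + ρ') - Real.tanh ρ)) :=
        mul_le_mul (inv_anti₀ hpos (hA.trans (le_abs_self _))) hI (abs_nonneg _)
          (inv_nonneg.2 hpos.le)
    _ = C / (ρ' - 1) := by
        have : ρ' - 1 ≠ 0 := by linarith
        field_simp

end PoincareDisk

/-! ### Push-forward to the manifold and passage to the limit. -/

-- Only almost everywhere measurability is available, since `j` is arbitrary off the disk; the disk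
-- measure does not charge that complement.
open SurfaceFoliation in
theorem aemeasurable_leafUniformization {q : ℕ} {M : Type*} [TopologicalSpace M]
    [ChartedSpace (EuclideanSpace ℝ (Fin (q + 2))) M] [MeasurableSpace M] [BorelSpace M]
    {F : SurfaceFoliation q M} {g : F.LeafMetric} {x : M} {j : ℂ → M}
    (hj : g.IsLeafUniformization x j) (ρ ρ' : ℝ) :
    AEMeasurable j (PoincareDisk.diskMeasure ρ ρ') := by
  have h : AEMeasurable j (volume.restrict (Metric.ball (0 : ℂ) 1)) :=
    ContinuousOn.aemeasurable (fun z hz => (hj.continuousAt hz).continuousWithinAt)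
      Metric.isOpen_ball.measurableSet
  exact (h.mono_ac (withDensity_absolutelyContinuous _ _)).smul_measure _

end

theorem theorem3p1 {q : ℕ} {M : Type*} [TopologicalSpace M] [T2Space M] [CompactSpace M]
    [ChartedSpace (EuclideanSpace ℝ (Fin (q + 2))) M] [IsManifold (𝓡 (q + 2)) ∞ M]
    [MeasurableSpace M] [BorelSpace M]
    (F : SurfaceFoliation q M) (g : F.LeafMetric) (hg : g.IsHyperbolic)
    (x : ℕ → M) (j : ℕ → ℂ → M) (hj : ∀ n, g.IsLeafUniformization (x n) (j n))
    (ρ ρ' : ℕ → ℝ) (hρ_pos : ∀ n, 0 < ρ n) (hρ'_pos : ∀ n, 0 < ρ' n)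
    (hρ : Tendsto ρ atTop atTop) (hρ' : Tendsto ρ' atTop atTop)
    (μ : Measure M) [IsProbabilityMeasure μ]
    (hμ : ∀ f : C(M, ℝ), Tendsto
      (fun n => ∫ y, f y ∂((PoincareDisk.diskMeasure (ρ n) (ρ' n)).map (j n)))
      atTop (𝓝 (∫ y, f y ∂μ))) :
    g.IsHarmonic μ := by
  intro f hf
  have hL := g.continuous_leafLaplacian hf
  refine ⟨hL.integrable_of_hasCompactSupport (HasCompactSupport.of_compactSpace _), ?_⟩
  -- Compactness of `M` gives one bound `C` for all the pullbacks `f ∘ j n`, whatever the leaves.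
  obtain ⟨C, hC⟩ := isCompact_univ.exists_bound_of_continuousOn hf.continuous.continuousOn
  have hbound : ∀ᶠ n in atTop, |∫ y, g.leafLaplacian f y
      ∂((PoincareDisk.diskMeasure (ρ n) (ρ' n)).map (j n))| ≤ C / (ρ' n - 1) := by
    filter_upwards [hρ'.eventually_gt_atTop 1] with n hn
    rw [integral_map (aemeasurable_leafUniformization (hj n) _ _) hL.aestronglyMeasurable]
    exact PoincareDisk.abs_integral_diskMeasure_laplacian_le (hρ_pos n) hn
      ((hj n).contDiffOn_comp hf) (fun z _ => hC _ (mem_univ _))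
      fun z hz => (hj n).leafLaplacian_comp hf hz
  have hzero : Tendsto (fun n => C / (ρ' n - 1)) atTop (𝓝 0) :=
    (tendsto_atTop_add_const_right _ (-1) hρ').const_div_atTop C
  exact tendsto_nhds_unique (hμ ⟨g.leafLaplacian f, hL⟩) (squeeze_zero_norm' hbound hzero)
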